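/- Let $A_1,A_2\in\mathbb R^{n\times n}$, $e_1,e_2,c\in\mathbb R^n$ and $f\in\mathbb R$. Consider the bimodal piecewise affine system $\dot x\in F(x)$, where $F(x)=\{A_1x+e_1\}$ if $c^Tx+f<0$, $F(x)=\{A_1x+e_1,A_2x+e_2\}$ if $c^Tx+f=0$, and $F(x)=\{A_2x+e_2\}$ if $c^Tx+f>0$; let $G(x)$ be the convex hull of $F(x)$. Solutions are (locally) absolutely continuous functions $x:\mathbb R\to\mathbb R^n$ with $x(0)=\xi$. Such an $x$ is a *Filippov* (resp. *Carathéodory*) solution for the initial state $\xi$ if $\dot x(t)\in G(x(t))$ (resp. $\dot x(t)\in F(x(t))$) for almost all $t\in\mathbb R$. A Carathéodory solution is a *forward* (resp. *backward*) Carathéodory solution if for each $t^*\in\mathbb R$ there are $i\in\{1,2\}$ and $\epsilon>0$ with $\dot x(t)=A_ix(t)+e_i$ and $(-1)^{i-1}[c^Tx(t)+f]\le 0$ for all $t\in(t^*,t^*+\epsilon)$ (resp. all $t\in(t^*-\epsilon,t^*)$). A Filippov solution $x$ for $\xi$ is *right-unique* if for each Filippov solution $x'$ for $\xi$ there is $\epsilon>0$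 with $x=x'$ on $[0,\epsilon)$. For $k\ge 0$ let $T_i^k$ be the matrix with rows $c^T,c^TA_i,\dots,c^TA_i^k$ and let $\mathbf e_i^k=(f,\,c^Te_i,\,c^TA_ie_i,\dots,c^TA_i^{k-1}e_i)^T\in\mathbb R^{k+1}$. The observability index $h_i$ of $(c^T,A_i)$ is the largest $k\ge0$ such that $T_i^k$ has full row rank (if $c=0$, put $h_i=0$). Let $h=\min\{h_1,h_2\}$. For vectors, $v\succ w$ means that $v-w\neq0$ and the first nonzero entry of $v-w$ is positive. Consider the following statements. 1. Every Filippov solution (for every initial state) is right-unique. 2. Every Filippov solution is both a forward and a backward Carathéodory solution. 3. There exist an integer $k$ with $1\le k\le h+1$ and a $(k+1)\times(k+1)$ lower triangular matrix $M$ with positive diagonal elements such that $T_1^k=MT_2^k$ and $\mathbf e_1^k\succ M\mathbf e_2^k$. 4. There exists an $(h+1)\times(h+1)$ lower triangular matrix $M$ with positive diagonal elements such that $T_1^h=MT_2^h$ and $\mathbf e_1^h=M\mathbf e_2^h$; and either $h_1<h_2$ and $c^TA_1^{h_1}e_1-p_1^T\mathbf e_1^{h_1}>0$, or $h_1>h_2$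 and $c^TA_2^{h_2}e_2-p_2^T\mathbf e_2^{h_2}<0$, where $p_i$ is determined by $c^TA_i^{h_i+1}=p_i^TT_i^{h_i}$ (uniquely if $c\ne0$). 5. $h_1=h_2$ and there exists an $(h+2)\times(h+2)$ lower triangular matrix $M$ with positive diagonal elements such that $T_1^{h+1}=MT_2^{h+1}$ and $\mathbf e_1^{h+1}=M\mathbf e_2^{h+1}$. 6. For every $\xi\in\mathbb R^n$, $T_1^{h+1}\xi+\mathbf e_1^{h+1}=0$ implies $A_1\xi+e_1=A_2\xi+e_2$. Then the following implications hold: (A) $1\Rightarrow(3\text{ or }4\text{ or }5)$; (B) $(1\text{ and }5)\Rightarrow6$; (C) $(5\text{ and }6)\Rightarrow2$; (D) $(5\text{ and }6)\Rightarrow1$. -/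

import Mathlib

open Matrix

/-- The data of a bimodal piecewise affine system on `ℝⁿ`: the two modes `x ↦ A i x + e i`
(`i = 0` is the first mode, `i = 1` the second) and the affine switching function
`x ↦ cᵀ x + f`. -/
structure BimodalSystem (n : ℕ) where
  A : Fin 2 → Matrix (Fin n) (Fin n) ℝ
  e : Fin 2 → Fin n → ℝ
  c : Fin n → ℝ
  f : ℝ

namespace BimodalSystem

variable {n : ℕ}

/-- The vector field `A i x + e i` of mode `i`. -/
def mode (S : BimodalSystem n) (i : Fin 2) (x : Fin n → ℝ) : Fin n → ℝ :=
  S.A i *ᵥ x + S.e i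

/-- The switching function `cᵀ x + f`. -/
def output (S : BimodalSystem n) (x : Fin n → ℝ) : ℝ :=
  S.c ⬝ᵥ x + S.f

/-- The set-valued right-hand side `F` of the bimodal system. -/
noncomputable def rhs (S : BimodalSystem n) (x : Fin n → ℝ) : Set (Fin n → ℝ) :=
  if S.output x < 0 then {S.mode 0 x}
  else if S.output x = 0 then {S.mode 0 x, S.mode 1 x}
  else {S.mode 1 x}

/-- The convexified set-valued right-hand side `G`. -/
noncomputable def convexRhs (S : BimodalSystem n) (x : Fin n → ℝ) : Set (Fin n → ℝ) :=
  if S.output x < 0 then {S.mode 0 x}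
  else if S.output x = 0 then convexHull ℝ {S.mode 0 x, S.mode 1 x}
  else {S.mode 1 x}

/-- Absolute continuity of a curve on `ℝ`: absolute continuity on every compact interval. -/
def AbsCont (x : ℝ → Fin n → ℝ) : Prop :=
  ∀ a b : ℝ, AbsolutelyContinuousOnInterval x a b

/-- Carathéodory solutions for the initial state `ξ`. -/
def IsCaratheodory (S : BimodalSystem n) (ξ : Fin n → ℝ) (x : ℝ → Fin n → ℝ) : Prop :=
  AbsCont x ∧ x 0 = ξ ∧ ∀ᵐ t : ℝ, ∃ v ∈ S.rhs (x t), HasDerivAt x v t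

/-- At time `t` the curve `x` obeys mode `i` and lies in the closed half-space of mode `i`. -/
def ObeysMode (S : BimodalSystem n) (x : ℝ → Fin n → ℝ) (i : Fin 2) (t : ℝ) : Prop :=
  HasDerivAt x (S.mode i (x t)) t ∧ (-1 : ℝ) ^ (i : ℕ) * S.output (x t) ≤ 0

/-- Forward Carathéodory solutions. -/
def IsForwardCaratheodory (S : BimodalSystem n) (ξ : Fin n → ℝ) (x : ℝ → Fin n → ℝ) : Prop :=
  S.IsCaratheodory ξ x ∧
    ∀ s : ℝ, ∃ i : Fin 2, ∃ ε > 0, ∀ t ∈ Set.Ioo s (s + ε), S.ObeysMode x i t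

/-- Backward Carathéodory solutions. -/
def IsBackwardCaratheodory (S : BimodalSystem n) (ξ : Fin n → ℝ) (x : ℝ → Fin n → ℝ) : Prop :=
  S.IsCaratheodory ξ x ∧
    ∀ s : ℝ, ∃ i : Fin 2, ∃ ε > 0, ∀ t ∈ Set.Ioo (s - ε) s, S.ObeysMode x i t

/-- Filippov solutions for the initial state `ξ`. -/
def IsFilippov (S : BimodalSystem n) (ξ : Fin n → ℝ) (x : ℝ → Fin n → ℝ) : Prop :=
  AbsCont x ∧ x 0 = ξ ∧ ∀ᵐ t : ℝ, ∃ v ∈ S.convexRhs (x t), HasDerivAt x v t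

/-- Right-uniqueness of a solution `x` for the initial state `ξ`. -/
def IsRightUnique (S : BimodalSystem n) (ξ : Fin n → ℝ) (x : ℝ → Fin n → ℝ) : Prop :=
  ∀ x' : ℝ → Fin n → ℝ, S.IsFilippov ξ x' → ∃ ε > 0, ∀ t ∈ Set.Ico 0 ε, x t = x' t

/-- `T i k`: the matrix with the `k + 1` rows `cᵀ, cᵀ A, …, cᵀ Aᵏ`, where `A = A i`. -/
def T (S : BimodalSystem n) (i : Fin 2) (k : ℕ) : Matrix (Fin (k + 1)) (Fin n) ℝ :=
  Matrix.of fun j => S.c ᵥ* S.A i ^ (j : ℕ)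

/-- `E i k`: the vector with the `k + 1` entries `f, cᵀ e, cᵀ A e, …, cᵀ Aᵏ⁻¹ e`, where
`A = A i` and `e = e i`. -/
def E (S : BimodalSystem n) (i : Fin 2) (k : ℕ) : Fin (k + 1) → ℝ :=
  Fin.cons S.f fun j : Fin k => S.c ⬝ᵥ (S.A i ^ (j : ℕ) *ᵥ S.e i)

/-- The observability index of `(cᵀ, A i)`: the largest `k` such that `T i k` has full row rank.
For `c ≠ 0` the set below is non-empty and bounded by `n`, so that the supremum is a maximum;
for `c = 0` it is empty and the index is `0`. -/
noncomputable def obsIndex (S : BimodalSystem n) (i : Fin 2) : ℕ :=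
  sSup {k : ℕ | LinearIndependent ℝ (S.T i k).row}

/-- `h`, the smaller of the two observability indices. -/
noncomputable def minIndex (S : BimodalSystem n) : ℕ :=
  min (S.obsIndex 0) (S.obsIndex 1)

/-- `v ≻ 0`: the vector `v` is nonzero and its first nonzero entry is positive. -/
def LexPos {m : ℕ} (v : Fin m → ℝ) : Prop :=
  ∃ i, 0 < v i ∧ ∀ j < i, v j = 0

/-- Lower triangular matrices with positive diagonal entries. -/
def IsLowerPos {m : ℕ} (M : Matrix (Fin m) (Fin m) ℝ) : Prop :=
  (∀ i j, i < j → M i j = 0) ∧ ∀ i, 0 < M i i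

/-- Every Filippov solution is right-unique. -/
def RightUniqueness (S : BimodalSystem n) : Prop :=
  ∀ ξ x, S.IsFilippov ξ x → S.IsRightUnique ξ x

/-- Every Filippov solution is both a forward and a backward Carathéodory solution. -/
def FilippovIsCaratheodory (S : BimodalSystem n) : Prop :=
  ∀ ξ x, S.IsFilippov ξ x → S.IsForwardCaratheodory ξ x ∧ S.IsBackwardCaratheodory ξ x

/-- The lexicographic inequality condition. -/
def LexCondition (S : BimodalSystem n) : Prop :=
  ∃ k : ℕ, 1 ≤ k ∧ k ≤ S.minIndex + 1 ∧ ∃ M : Matrix (Fin (k + 1)) (Fin (k + 1)) ℝ,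
    IsLowerPos M ∧ S.T 0 k = M * S.T 1 k ∧ LexPos (S.E 0 k - M *ᵥ S.E 1 k)

/-- The number `cᵀ Aʰ e - pᵀ E` is positive (`σ = 1`) or negative (`σ = -1`), where `A = A i`,
`e = e i`, `h` is the observability index of `(cᵀ, A)`, `E = E i h`, and `p` is the vector with
`cᵀ Aʰ⁺¹ = pᵀ T`, `T = T i h`, which is unique since the rows of `T` are linearly independent. -/
def SignCondition (S : BimodalSystem n) (i : Fin 2) (σ : ℝ) : Prop :=
  ∃ p : Fin (S.obsIndex i + 1) → ℝ,
    S.c ᵥ* S.A i ^ (S.obsIndex i + 1) = p ᵥ* S.T i (S.obsIndex i) ∧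
    0 < σ * (S.c ⬝ᵥ (S.A i ^ S.obsIndex i *ᵥ S.e i) - p ⬝ᵥ S.E i (S.obsIndex i))

/-- Equality up to order `h`, different observability indices and a sign condition. -/
def UnequalIndexCondition (S : BimodalSystem n) : Prop :=
  (∃ M : Matrix (Fin (S.minIndex + 1)) (Fin (S.minIndex + 1)) ℝ,
    IsLowerPos M ∧ S.T 0 S.minIndex = M * S.T 1 S.minIndex ∧
      S.E 0 S.minIndex = M *ᵥ S.E 1 S.minIndex) ∧
  ((S.obsIndex 0 < S.obsIndex 1 ∧ S.SignCondition 0 1) ∨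
    (S.obsIndex 1 < S.obsIndex 0 ∧ S.SignCondition 1 (-1)))

/-- Equal observability indices and equality up to order `h + 1`. -/
def EqualIndexCondition (S : BimodalSystem n) : Prop :=
  S.obsIndex 0 = S.obsIndex 1 ∧
  ∃ M : Matrix (Fin (S.minIndex + 1 + 1)) (Fin (S.minIndex + 1 + 1)) ℝ,
    IsLowerPos M ∧ S.T 0 (S.minIndex + 1) = M * S.T 1 (S.minIndex + 1) ∧
      S.E 0 (S.minIndex + 1) = M *ᵥ S.E 1 (S.minIndex + 1)

/-- The kernel implication. -/
def KernelCondition (S : BimodalSystem n) : Prop :=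
  ∀ ξ : Fin n → ℝ, S.T 0 (S.minIndex + 1) *ᵥ ξ + S.E 0 (S.minIndex + 1) = 0 →
    S.A 0 *ᵥ ξ + S.e 0 = S.A 1 *ᵥ ξ + S.e 1

end BimodalSystem

section

/-! ### Calculus of absolutely continuous curves. -/

open Set MeasureTheory Filter Topology

/-! Everything is read off the iterated Lie derivatives of the output along the two modes, `lie i
j`.

Sufficiency, (C) and (D): the matrix relation in statement 5 says that each Lie derivative along the
first mode is a positive multiple of the one along the second mode plus lower ones. Hence, along any
Filippov solution, whatever convex combination of modes it uses, the functions `lie 1 j (x t)` form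
a chain of integrators with positive gains, perturbed only by lower members
(`IsFilippov.exists_isIntegratorChain`). In such a chain the first nonzero member at a time fixes
the strict sign of the output just after it, and just before it up to the parity of its order. So
switching times are isolated as long as the members never all vanish. The row of order `h + 1`
depends on the earlier ones, so by Grönwall a common zero stays one for all time; there the kernel
condition makes the two modes agree. Thus a solution locally follows a single mode, and the initial
state decides which.

Necessity, (A) and (B): if from `ξ` each mode can be followed for a short time inside its own closed
half-space, right-uniqueness makes the two flows coincide, which forces zero output, vanishing Lie
derivatives and equal vector fields at `ξ` (`RightUniqueness.eq_of_lieSign`). Below the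
observability indices the Lie derivatives take arbitrary values, so testing well-chosen `ξ` builds
the triangular relation one order at a time (`RightUniqueness.exists_lieRel_succ`). A positive
constant term gives statement 3; otherwise order `h` is reached and comparing the two indices gives
3, 4 or 5. Statement 6 is the case in which both flows stay on the switching hyperplane.

Solutions live on all of `ℝ`, so local arcs must be extended; this uses an existence theorem proved
by the Euler scheme. -/

theorem AbsolutelyContinuousOnInterval.apply {ι : Type*} [Fintype ι] {x : ℝ → ι → ℝ} {a b : ℝ}
    (hx : AbsolutelyContinuousOnInterval x a b) (k : ι) :
    AbsolutelyContinuousOnInterval (fun t => x t k) a b := by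
  rw [absolutelyContinuousOnInterval_iff] at hx ⊢
  intro ε hε
  obtain ⟨δ, hδ, h⟩ := hx ε hε
  refine ⟨δ, hδ, fun E hE hlt => lt_of_le_of_lt ?_ (h E hE hlt)⟩
  exact Finset.sum_le_sum fun i _ => dist_le_pi_dist _ _ k

theorem LocallyLipschitz.absolutelyContinuousOnInterval {X : Type*} [PseudoMetricSpace X]
    {f : ℝ → X} (hf : LocallyLipschitz f) (a b : ℝ) : AbsolutelyContinuousOnInterval f a b := by
  obtain ⟨K, hK⟩ := (hf.locallyLipschitzOn (s := uIcc a b)).exists_lipschitzOnWith_of_compact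
    isCompact_uIcc
  exact hK.absolutelyContinuousOnInterval

theorem AbsolutelyContinuousOnInterval.sub_le_integral {z g : ℝ → ℝ} {a b : ℝ} (hab : a ≤ b)
    (hz : AbsolutelyContinuousOnInterval z a b) (hg : ContinuousOn g (Icc a b))
    (h : ∀ᵐ t, t ∈ Ioo a b → ∃ d ≤ g t, HasDerivAt z d t) :
    z b - z a ≤ ∫ t in a..b, g t := by
  rw [← hz.integral_deriv_eq_sub]
  refine intervalIntegral.integral_mono_ae_restrict hab hz.intervalIntegrable_deriv
    (ContinuousOn.intervalIntegrable (by rwa [uIcc_of_le hab])) ?_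
  rw [Filter.EventuallyLE, ae_restrict_iff' measurableSet_Icc]
  have ha : ∀ᵐ t : ℝ, t ≠ a := by simp [ae_iff, measure_singleton]
  have hb : ∀ᵐ t : ℝ, t ≠ b := by simp [ae_iff, measure_singleton]
  filter_upwards [h, ha, hb] with t ht h1 h2 h3
  obtain ⟨d, hd, hd'⟩ := ht ⟨lt_of_le_of_ne h3.1 h1.symm, lt_of_le_of_ne h3.2 h2⟩
  rwa [hd'.deriv]

theorem AbsolutelyContinuousOnInterval.norm_sub_le_integral {ι : Type*} [Fintype ι]
    {x : ℝ → ι → ℝ} {g : ℝ → ℝ} {a b : ℝ} (hab : a ≤ b)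
    (hx : AbsolutelyContinuousOnInterval x a b) (hg : ContinuousOn g (Icc a b))
    (h : ∀ᵐ t, t ∈ Ioo a b → ∃ v, ‖v‖ ≤ g t ∧ HasDerivAt x v t)
    (hg0 : ∀ t ∈ Icc a b, 0 ≤ g t) :
    ‖x b - x a‖ ≤ ∫ t in a..b, g t := by
  rw [pi_norm_le_iff_of_nonneg (intervalIntegral.integral_nonneg hab hg0)]
  intro k
  rw [Pi.sub_apply, Real.norm_eq_abs, abs_le']
  constructor
  · refine (hx.apply k).sub_le_integral hab hg ?_
    filter_upwards [h] with t ht htm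
    obtain ⟨v, hv, hd⟩ := ht htm
    exact ⟨v k, (le_abs_self _).trans ((norm_le_pi_norm v k).trans hv), hasDerivAt_pi.1 hd k⟩
  · have := (hx.apply k).fun_neg.sub_le_integral hab hg ?_
    · linarith
    filter_upwards [h] with t ht htm
    obtain ⟨v, hv, hd⟩ := ht htm
    exact ⟨-v k, (neg_le_abs _).trans ((norm_le_pi_norm v k).trans hv),
      (hasDerivAt_pi.1 hd k).fun_neg⟩

/-- Grönwall's lemma for absolutely continuous curves. -/
theorem AbsolutelyContinuousOnInterval.eq_zero_of_norm_deriv_le {ι : Type*} [Fintype ι]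
    {x : ℝ → ι → ℝ} {C a b : ℝ} (hC : 0 ≤ C) (hx : AbsolutelyContinuousOnInterval x a b)
    (hxc : Continuous x)
    (h : ∀ᵐ t, t ∈ Ioo a b → ∃ v, ‖v‖ ≤ C * ‖x t‖ ∧ HasDerivAt x v t) (h0 : x a = 0) :
    ∀ t ∈ Icc a b, x t = 0 := by
  intro t ht
  have hab : a ≤ b := ht.1.trans ht.2
  have key : ∀ s ∈ Icc a b, ‖x s‖ ≤ C * ∫ r in a..s, ‖x r‖ := by
    intro s hs
    have := AbsolutelyContinuousOnInterval.norm_sub_le_integral (x := x)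
      (g := fun r => C * ‖x r‖) hs.1
      (hx.mono (by rw [uIcc_of_le hab, uIcc_of_le hs.1]; exact Icc_subset_Icc_right hs.2))
      (by fun_prop) ?_ (fun r _ => by positivity)
    · simpa [h0] using this
    filter_upwards [h] with r hr hrm
    exact hr ⟨hrm.1, hrm.2.trans_le hs.2⟩
  have hderiv : ∀ s, HasDerivAt (fun s => ∫ r in a..s, ‖x r‖) ‖x s‖ s := fun s =>
    intervalIntegral.integral_hasDerivAt_right (hxc.norm.intervalIntegrable _ _)
      (hxc.norm.stronglyMeasurableAtFilter _ _) hxc.norm.continuousAt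
  -- Grönwall is applied to the integral of `‖x‖`, which is differentiable everywhere, while `x` is
  -- so only almost everywhere.
  have hU := eq_zero_of_abs_deriv_le_mul_abs_self_of_eq_zero_right
    (f := fun s => ∫ r in a..s, ‖x r‖) (f' := fun s => ‖x s‖) (K := C) (a := a) (b := b)
    (fun s _ => (hderiv s).continuousAt.continuousWithinAt)
    (fun s _ => (hderiv s).hasDerivWithinAt) (by simp) (fun s hs => by
      rw [norm_norm]
      refine (key s ⟨hs.1, hs.2.le⟩).trans ?_
      gcongr
      exact le_abs_self _) t ht
  have := key t ht
  rw [hU, mul_zero] at this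
  exact norm_le_zero_iff.1 this

/-- The difference of `x` and a primitive of `g` is absolutely continuous with derivative zero
almost everywhere, hence locally constant. This upgrades almost-everywhere equations to classical
ones wherever the right-hand side is continuous. -/
theorem LocallyLipschitz.hasDerivAt_of_ae {ι : Type*} [Fintype ι] {x g : ℝ → ι → ℝ} {a b : ℝ}
    (hx : LocallyLipschitz x) (hg : Continuous g)
    (h : ∀ᵐ t, t ∈ Ioo a b → HasDerivAt x (g t) t) :
    ∀ t ∈ Ioo a b, HasDerivAt x (g t) t := by
  intro t ht
  have hI : ∀ s, HasDerivAt (fun s => ∫ r in t..s, g r) (g s) s := fun s =>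
    intervalIntegral.integral_hasDerivAt_right (hg.intervalIntegrable _ _)
      (hg.stronglyMeasurableAtFilter _ _) hg.continuousAt
  have hIc : LocallyLipschitz (fun s => ∫ r in t..s, g r) := by
    refine ContDiff.locallyLipschitz (𝕂 := ℝ) ?_
    rw [contDiff_one_iff_deriv]
    refine ⟨fun s => (hI s).differentiableAt, ?_⟩
    rwa [show deriv (fun s => ∫ r in t..s, g r) = g from funext fun s => (hI s).deriv]
  obtain ⟨p, hp, hpt⟩ := exists_between ht.1
  obtain ⟨q, htq, hq⟩ := exists_between ht.2
  have hpq : p ≤ q := (hpt.trans htq).le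
  obtain ⟨c, hc⟩ := ((hx.absolutelyContinuousOnInterval p q).fun_sub
    (hIc.absolutelyContinuousOnInterval p q)).const_of_ae_hasDerivAt_zero (by
      filter_upwards [h] with s hs hsm
      rw [uIcc_of_le hpq] at hsm
      simpa using (hs ⟨hp.trans_le hsm.1, hsm.2.trans_lt hq⟩).fun_sub (hI s))
  rw [uIcc_of_le hpq] at hc
  have : x =ᶠ[𝓝 t] fun s => c + ∫ r in t..s, g r := by
    filter_upwards [Icc_mem_nhds hpt htq] with s hs
    rw [← hc s hs]; simp
  exact ((hI t).const_add c).congr_of_eventuallyEq this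

/-! ### Perturbed chains of integrators. -/

/-- Locally Lipschitz functions `z 0, …, z N` which form a perturbed chain of integrators:
for almost all `t` and all `i < N`, `z i` has a derivative at `t` which equals `α * z (i + 1) t` for
some `α ∈ [a, b]` up to a linear error in `z 0 t, …, z i t`. -/
structure IsIntegratorChain (N : ℕ) (a b C : ℝ) (z : ℕ → ℝ → ℝ) : Prop where
  locallyLipschitz : ∀ i, LocallyLipschitz (z i)
  ae_deriv : ∀ᵐ t, ∀ i < N, ∃ d α, HasDerivAt (z i) d t ∧ a ≤ α ∧ α ≤ b ∧
    |d - α * z (i + 1) t| ≤ C * ∑ l ∈ Finset.range (i + 1), |z l t|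

theorem exists_first_ne_zero {N : ℕ} {w : ℕ → ℝ} (h : ¬∀ l ≤ N, w l = 0) :
    ∃ j ≤ N, (∀ l < j, w l = 0) ∧ (w j < 0 ∨ 0 < w j) := by
  classical
  push Not at h
  obtain ⟨hjN, hj0⟩ := Nat.find_spec h
  refine ⟨Nat.find h, hjN, fun l hl => ?_, hj0.lt_or_gt⟩
  by_contra hcon
  exact Nat.find_min h hl ⟨hl.le.trans hjN, hcon⟩

namespace IsIntegratorChain

variable {N : ℕ} {a b C : ℝ} {z : ℕ → ℝ → ℝ}

theorem neg (h : IsIntegratorChain N a b C z) :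
    IsIntegratorChain N a b C (fun i t => -z i t) where
  locallyLipschitz i := (h.locallyLipschitz i).neg
  ae_deriv := by
    filter_upwards [h.ae_deriv] with t ht i hi
    obtain ⟨d, α, hd, h1, h2, h3⟩ := ht i hi
    refine ⟨-d, α, hd.fun_neg, h1, h2, ?_⟩
    rw [show -d - α * -z (i + 1) t = -(d - α * z (i + 1) t) by ring, abs_neg]
    simpa only [abs_neg] using h3

theorem comp_add (h : IsIntegratorChain N a b C z) (t₀ : ℝ) :
    IsIntegratorChain N a b C (fun i t => z i (t + t₀)) where
  locallyLipschitz i := (h.locallyLipschitz i).comp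
    (LipschitzWith.id.add (LipschitzWith.const t₀)).locallyLipschitz
  ae_deriv := by
    have := (measurePreserving_add_right volume t₀).quasiMeasurePreserving.ae h.ae_deriv
    filter_upwards [this] with t ht i hi
    obtain ⟨d, α, hd, h1⟩ := ht i hi
    exact ⟨d, α, HasDerivAt.comp_add_const t t₀ hd, h1⟩

/-- Reversing time flips every derivative; the alternating factor keeps the gains `α` positive, so
forward results give backward ones. -/
theorem comp_neg (h : IsIntegratorChain N a b C z) :
    IsIntegratorChain N a b C (fun i t => (-1) ^ i * z i (-t)) where
  locallyLipschitz i := by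
    have : LocallyLipschitz fun t => z i (-t) :=
      (h.locallyLipschitz i).comp (LipschitzWith.id (α := ℝ)).neg.locallyLipschitz
    rcases neg_one_pow_eq_or ℝ i with h | h
    · simpa [h] using this
    · simp only [h, neg_mul, one_mul]
      exact this.neg
  ae_deriv := by
    have := (Measure.measurePreserving_neg (volume : Measure ℝ)).quasiMeasurePreserving.ae
      h.ae_deriv
    filter_upwards [this] with t ht i hi
    obtain ⟨d, α, hd, h1, h2, h3⟩ := ht i hi
    have h4 : HasDerivAt (fun t => z i (-t)) (-d) t := by
      simpa [Function.comp_def] using HasDerivAt.scomp t hd (hasDerivAt_neg t)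
    refine ⟨(-1) ^ i * -d, α, h4.const_mul _, h1, h2, ?_⟩
    rw [show (-1) ^ i * -d - α * ((-1) ^ (i + 1) * z (i + 1) (-t)) =
      (-1) ^ (i + 1) * (d - α * z (i + 1) (-t)) by ring, abs_mul]
    simpa [abs_mul] using h3

/-- Says `z i t = O(t ^ (j - i))`: the derivative of `z i` is bounded by `z (i + 1)` and lower
members, so each integration from the zero initial value gains one power of `t`. -/
theorem exists_abs_le (h : IsIntegratorChain N a b C z) (ha : 0 < a) (hC : 0 ≤ C) {j : ℕ}
    (hj : j ≤ N) (h0 : ∀ l < j, z l 0 = 0) (m : ℕ) :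
    ∃ K, 0 ≤ K ∧ ∀ i, i + m ≤ j → ∀ t ∈ Icc (0 : ℝ) 1, |z i t| ≤ K * t ^ m := by
  induction m with
  | zero =>
    have : ∀ i, ∃ K, ∀ t ∈ Icc (0 : ℝ) 1, ‖z i t‖ ≤ K := fun i =>
      isCompact_Icc.exists_bound_of_continuousOn (h.locallyLipschitz i).continuous.continuousOn
    choose K hK using this
    have hK0 : ∀ i, 0 ≤ K i := fun i =>
      (norm_nonneg _).trans (hK i 0 ⟨le_rfl, zero_le_one⟩)
    refine ⟨∑ i ∈ Finset.range (j + 1), K i, Finset.sum_nonneg fun i _ => hK0 i,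
      fun i hi t ht => ?_⟩
    rw [pow_zero, mul_one]
    exact (hK i t ht).trans (Finset.single_le_sum (fun i _ => hK0 i)
      (Finset.mem_range.2 (by omega)))
  | succ m ih =>
    obtain ⟨K, hK0, hK⟩ := ih
    rcases Nat.eq_zero_or_pos N with hN | hN
    · exact ⟨0, le_rfl, fun i hi => by omega⟩
    -- Positivity of `b` comes from `a ≤ α ≤ b` at one good time; this needs a link in the chain,
    -- hence `0 < N`.
    have hb : 0 < b := by
      obtain ⟨t, ht⟩ := h.ae_deriv.exists
      obtain ⟨d, α, -, h1, h2, -⟩ := ht 0 hN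
      linarith
    refine ⟨(b + C * (j + 1)) * K, by positivity, fun i hi t ht => ?_⟩
    have hbound : ∀ᵐ s, s ∈ Ioo 0 t → ∃ d, |d| ≤ (b + C * (j + 1)) * K * t ^ m ∧
        HasDerivAt (z i) d s := by
      filter_upwards [h.ae_deriv] with s hs hst
      obtain ⟨d, α, hd, h1, h2, h3⟩ := hs i (by omega)
      refine ⟨d, ?_, hd⟩
      have hs1 : s ∈ Icc (0 : ℝ) 1 := ⟨hst.1.le, hst.2.le.trans ht.2⟩
      have e1 : |α * z (i + 1) s| ≤ b * (K * s ^ m) := by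
        rw [abs_mul, abs_of_pos (ha.trans_le h1)]
        exact mul_le_mul h2 (hK (i + 1) (by omega) s hs1) (abs_nonneg _) hb.le
      have e2 : ∑ l ∈ Finset.range (i + 1), |z l s| ≤ (j + 1) * (K * s ^ m) := by
        calc ∑ l ∈ Finset.range (i + 1), |z l s|
            ≤ ∑ l ∈ Finset.range (i + 1), K * s ^ m := Finset.sum_le_sum fun l hl =>
              hK l (by have := Finset.mem_range.1 hl; omega) s hs1
          _ = (i + 1 : ℕ) * (K * s ^ m) := by simp
          _ ≤ (j + 1) * (K * s ^ m) := by
              have : ((i + 1 : ℕ) : ℝ) ≤ j + 1 := by exact_mod_cast (by omega : i + 1 ≤ j + 1)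
              have := pow_nonneg hs1.1 m
              gcongr
      have e3 : s ^ m ≤ t ^ m := pow_le_pow_left₀ hs1.1 hst.2.le m
      calc |d| = |(d - α * z (i + 1) s) + α * z (i + 1) s| := by ring_nf
        _ ≤ C * ((j + 1) * (K * s ^ m)) + b * (K * s ^ m) :=
            (abs_add_le _ _).trans (add_le_add (h3.trans (by gcongr)) e1)
        _ = (b + C * (j + 1)) * K * s ^ m := by ring
        _ ≤ _ := by gcongr
    have hac := (h.locallyLipschitz i).absolutelyContinuousOnInterval 0 t
    rw [abs_le']
    constructor
    · have := hac.sub_le_integral (g := fun _ => (b + C * (j + 1)) * K * t ^ m) ht.1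
        continuousOn_const (by
          filter_upwards [hbound] with s hs hst
          obtain ⟨d, h1, h2⟩ := hs hst
          exact ⟨d, (le_abs_self _).trans h1, h2⟩)
      rw [h0 i (by omega), sub_zero, intervalIntegral.integral_const] at this
      exact this.trans_eq (by simp; ring)
    · have := hac.fun_neg.sub_le_integral (g := fun _ => (b + C * (j + 1)) * K * t ^ m) ht.1
        continuousOn_const (by
          filter_upwards [hbound] with s hs hst
          obtain ⟨d, h1, h2⟩ := hs hst
          exact ⟨-d, (neg_le_abs _).trans h1, h2.fun_neg⟩)
      rw [h0 i (by omega), neg_zero, sub_zero, intervalIntegral.integral_const] at this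
      exact this.trans_eq (by simp; ring)

/-- Integrating down the chain from `z j` gives `z (j - m) t ≥ c * t ^ m`. The perturbation at the
next stage is `O(t ^ (m + 1))` by `exists_abs_le`, so it is negligible against the leading term. -/
theorem eventually_pos_zero (h : IsIntegratorChain N a b C z) (ha : 0 < a) (hC : 0 ≤ C) {j : ℕ}
    (hj : j ≤ N) (h0 : ∀ l < j, z l 0 = 0) (hpos : 0 < z j 0) :
    ∀ᶠ t in 𝓝[>] 0, 0 < z 0 t := by
  have key : ∀ m ≤ j, ∃ c > 0, ∃ r > 0, ∀ t ∈ Icc (0 : ℝ) r, c * t ^ m ≤ z (j - m) t := by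
    intro m
    induction m with
    | zero =>
      intro _
      have hc := (h.locallyLipschitz j).continuous.tendsto 0
      obtain ⟨r, hr, hb⟩ := Metric.eventually_nhds_iff.1
        (hc.eventually (lt_mem_nhds (half_lt_self hpos)))
      refine ⟨z j 0 / 2, half_pos hpos, r / 2, half_pos hr, fun t ht => ?_⟩
      have : dist t 0 < r := by
        rw [Real.dist_eq, sub_zero, abs_of_nonneg ht.1]; linarith [ht.2]
      simpa using (hb this).le
    | succ m ih =>
      intro hm
      obtain ⟨c, hc, r, hr, hcr⟩ := ih (by omega)
      obtain ⟨K, hK0, hK⟩ := h.exists_abs_le ha hC hj h0 (m + 1)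
      set D := C * (j * K) with hD
      have hD0 : 0 ≤ D := by positivity
      -- The radius ensures `D * s ≤ a * c / 2`, so the error eats at most half of the leading term
      -- `a * c * s ^ m`; integrating the rest produces the new constant.
      refine ⟨a * c / 2 / (m + 1), by positivity, min (min r 1) (a * c / 2 / (D + 1)),
        by positivity, fun t ht => ?_⟩
      obtain ⟨ht0, ht1⟩ := ht
      simp only [le_min_iff] at ht1
      obtain ⟨⟨htr, ht1⟩, htD⟩ := ht1
      have hlow : ∀ᵐ s, s ∈ Ioo 0 t → ∃ d ≤ -(a * c / 2 * s ^ m),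
          HasDerivAt (fun s => -z (j - (m + 1)) s) d s := by
        filter_upwards [h.ae_deriv] with s hs hst
        obtain ⟨d, α, hd, h1, h2, h3⟩ := hs (j - (m + 1)) (by omega)
        refine ⟨-d, ?_, hd.fun_neg⟩
        rw [show j - (m + 1) + 1 = j - m by omega] at h3
        have hs1 : s ∈ Icc (0 : ℝ) 1 := ⟨hst.1.le, hst.2.le.trans ht1⟩
        have hsm : 0 ≤ s ^ m := pow_nonneg hs1.1 m
        have e1 : a * (c * s ^ m) ≤ α * z (j - m) s :=
          mul_le_mul h1 (hcr s ⟨hs1.1, hst.2.le.trans htr⟩) (by positivity) (ha.le.trans h1)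
        have e2 : ∑ l ∈ Finset.range (j - m), |z l s| ≤ j * (K * s ^ (m + 1)) := by
          calc ∑ l ∈ Finset.range (j - m), |z l s|
              ≤ ∑ l ∈ Finset.range (j - m), K * s ^ (m + 1) := Finset.sum_le_sum fun l hl =>
                hK l (by have := Finset.mem_range.1 hl; omega) s hs1
            _ = (j - m : ℕ) * (K * s ^ (m + 1)) := by simp
            _ ≤ j * (K * s ^ (m + 1)) := by
                have : ((j - m : ℕ) : ℝ) ≤ j := by exact_mod_cast (by omega : j - m ≤ j)
                have := pow_nonneg hs1.1 (m + 1)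
                gcongr
        have e3 := (abs_le.1 (h3.trans (mul_le_mul_of_nonneg_left e2 hC))).1
        have e4 : D * s ≤ a * c / 2 := by
          have h5 : s ≤ a * c / 2 / (D + 1) := hst.2.le.trans htD
          rw [le_div_iff₀ (by positivity)] at h5
          nlinarith [hs1.1]
        have e5 : C * (j * (K * s ^ (m + 1))) ≤ a * c / 2 * s ^ m := by
          rw [show C * (j * (K * s ^ (m + 1))) = D * s * s ^ m by rw [hD]; ring]
          gcongr
        nlinarith
      have := ((h.locallyLipschitz (j - (m + 1))).absolutelyContinuousOnInterval 0
        t).fun_neg.sub_le_integral ht0 (by fun_prop) hlow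
      rw [h0 _ (by omega), intervalIntegral.integral_neg, intervalIntegral.integral_const_mul,
        integral_pow] at this
      have e : a * c / 2 / (m + 1) * t ^ (m + 1) = a * c / 2 * ((t ^ (m + 1) - 0 ^ (m + 1)) / (m + 1)) := by
        rw [zero_pow (by omega)]; ring
      rw [e]
      linarith
  obtain ⟨c, hc, r, hr, hcr⟩ := key j le_rfl
  filter_upwards [Ioo_mem_nhdsGT hr] with t ht
  have := hcr t ⟨ht.1.le, ht.2.le⟩
  rw [Nat.sub_self] at this
  exact lt_of_lt_of_le (mul_pos hc (pow_pos ht.1 j)) this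

theorem eventually_pos_right (h : IsIntegratorChain N a b C z) (ha : 0 < a) (hC : 0 ≤ C)
    {t₀ : ℝ} {j : ℕ} (hj : j ≤ N) (h0 : ∀ l < j, z l t₀ = 0) (hpos : 0 < z j t₀) :
    ∀ᶠ t in 𝓝[>] t₀, 0 < z 0 t := by
  have := (h.comp_add t₀).eventually_pos_zero ha hC hj (by simpa using h0) (by simpa using hpos)
  have h2 : Tendsto (fun t => t - t₀) (𝓝[>] t₀) (𝓝[>] 0) := by
    refine tendsto_nhdsWithin_iff.2 ⟨?_, ?_⟩
    · exact ((continuous_sub_right t₀).tendsto' _ _ (sub_self _)).mono_left inf_le_left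
    · filter_upwards [self_mem_nhdsWithin] with t ht
      exact sub_pos.2 (mem_Ioi.1 ht)
  simpa using h2.eventually this

theorem eventually_neg_right (h : IsIntegratorChain N a b C z) (ha : 0 < a) (hC : 0 ≤ C)
    {t₀ : ℝ} {j : ℕ} (hj : j ≤ N) (h0 : ∀ l < j, z l t₀ = 0) (hneg : z j t₀ < 0) :
    ∀ᶠ t in 𝓝[>] t₀, z 0 t < 0 := by
  simpa using h.neg.eventually_pos_right ha hC hj (fun l hl => by rw [h0 l hl, neg_zero])
    (neg_pos.2 hneg)

theorem eventually_pos_left (h : IsIntegratorChain N a b C z) (ha : 0 < a) (hC : 0 ≤ C)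
    {t₀ : ℝ} {j : ℕ} (hj : j ≤ N) (h0 : ∀ l < j, z l t₀ = 0) (hpos : 0 < (-1) ^ j * z j t₀) :
    ∀ᶠ t in 𝓝[<] t₀, 0 < z 0 t := by
  have := h.comp_neg.eventually_pos_right ha hC (t₀ := -t₀) hj
    (fun l hl => by simp [h0 l hl]) (by simpa using hpos)
  have h2 : Tendsto (fun t : ℝ => -t) (𝓝[<] t₀) (𝓝[>] (-t₀)) := tendsto_neg_nhdsLT
  simpa using h2.eventually this

/-- Away from the common zeros of the chain, `z 0` has a constant sign on a right neighbourhood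
and on a left neighbourhood of each time. -/
theorem eventually_sign (h : IsIntegratorChain N a b C z) (ha : 0 < a) (hC : 0 ≤ C)
    {t₀ : ℝ} (hne : ¬∀ l ≤ N, z l t₀ = 0) :
    ((∀ᶠ t in 𝓝[>] t₀, 0 < z 0 t) ∨ ∀ᶠ t in 𝓝[>] t₀, z 0 t < 0) ∧
    ((∀ᶠ t in 𝓝[<] t₀, 0 < z 0 t) ∨ ∀ᶠ t in 𝓝[<] t₀, z 0 t < 0) := by
  obtain ⟨j, hjN, h0, hj0⟩ := exists_first_ne_zero hne
  constructor
  · rcases hj0 with hlt | hgt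
    · exact Or.inr (h.eventually_neg_right ha hC hjN h0 hlt)
    · exact Or.inl (h.eventually_pos_right ha hC hjN h0 hgt)
  · have : (-1) ^ j * z j t₀ ≠ 0 := mul_ne_zero (by simp) (hj0.elim ne_of_lt ne_of_gt)
    rcases this.lt_or_gt with hlt | hgt
    · right
      simpa using h.neg.eventually_pos_left ha hC hjN (fun l hl => by rw [h0 l hl, neg_zero])
        (by simpa using hlt)
    · exact Or.inl (h.eventually_pos_left ha hC hjN h0 hgt)

/-- The bound on `z N` closes the system: the vector of the first `N` members satisfies a linear
differential inequality, and Grönwall applies. -/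
theorem eq_zero_of_le (h : IsIntegratorChain N a b C z) (ha : 0 < a) (hC : 0 ≤ C) {C' : ℝ}
    (hC' : 0 ≤ C') (hN : ∀ t, |z N t| ≤ C' * ∑ l ∈ Finset.range N, |z l t|) {t₀ : ℝ}
    (h0 : ∀ l < N, z l t₀ = 0) {t : ℝ} (ht : t₀ ≤ t) : ∀ l ≤ N, z l t = 0 := by
  rcases Nat.eq_zero_or_pos N with rfl | hNpos
  · intro l hl
    have := hN t
    obtain rfl : l = 0 := by omega
    simpa using this
  have hb : 0 < b := by
    obtain ⟨t, ht⟩ := h.ae_deriv.exists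
    obtain ⟨d, α, -, h1, h2, -⟩ := ht 0 hNpos
    linarith
  set x : ℝ → Fin N → ℝ := fun t i => z i t with hx
  have hxl : LocallyLipschitz x := by
    intro s
    have : ∀ i : Fin N, ∃ K, ∃ t ∈ 𝓝 s, LipschitzOnWith K (z i) t := fun i =>
      h.locallyLipschitz i s
    choose K u hu hK using this
    refine ⟨∑ i, K i, ⋂ i, u i, Filter.iInter_mem.2 hu, ?_⟩
    refine LipschitzOnWith.of_dist_le_mul fun p hp q hq => ?_
    rw [dist_pi_le_iff (by positivity)]
    intro i
    refine ((hK i).dist_le_mul p (mem_iInter.1 hp i) q (mem_iInter.1 hq i)).trans ?_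
    gcongr
    exact Finset.single_le_sum (fun _ _ => zero_le) (Finset.mem_univ i)
  have hsum : ∀ m ≤ N, ∀ t, ∑ l ∈ Finset.range m, |z l t| ≤ N * ‖x t‖ := by
    intro m hm t
    calc ∑ l ∈ Finset.range m, |z l t| ≤ ∑ l ∈ Finset.range m, ‖x t‖ :=
          Finset.sum_le_sum fun l hl =>
            norm_le_pi_norm (x t) ⟨l, (Finset.mem_range.1 hl).trans_le hm⟩
      _ = m * ‖x t‖ := by simp
      _ ≤ N * ‖x t‖ := by gcongr
  have hz : ∀ l ≤ N, ∀ t, |z l t| ≤ (1 + C' * N) * ‖x t‖ := by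
    intro l hl t
    rcases hl.lt_or_eq with hl | rfl
    · have := norm_le_pi_norm (x t) ⟨l, hl⟩
      rw [Real.norm_eq_abs] at this
      nlinarith [norm_nonneg (x t), mul_nonneg (mul_nonneg hC' (Nat.cast_nonneg (α := ℝ) N)) (norm_nonneg (x t))]
    · have h1 := (hN t).trans (mul_le_mul_of_nonneg_left (hsum l le_rfl t) hC')
      nlinarith [norm_nonneg (x t)]
  have hzero : ∀ s ∈ Icc t₀ t, x s = 0 := by
    refine (hxl.absolutelyContinuousOnInterval t₀ t).eq_zero_of_norm_deriv_le
      (C := b * (1 + C' * N) + C * N) (by positivity) hxl.continuous ?_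
      (funext fun i => h0 i i.2)
    filter_upwards [h.ae_deriv] with s hs _
    choose! d α hd h1 h2 h3 using hs
    refine ⟨fun i => d i, ?_, hasDerivAt_pi.2 fun i => hd i i.2⟩
    rw [pi_norm_le_iff_of_nonneg (by positivity)]
    intro i
    have e1 : |α i * z (i + 1) s| ≤ b * ((1 + C' * N) * ‖x s‖) := by
      rw [abs_mul, abs_of_pos (ha.trans_le (h1 i i.2))]
      exact mul_le_mul (h2 i i.2) (hz (i + 1) (by omega) s) (abs_nonneg _) hb.le
    calc ‖d i‖ = |(d i - α i * z (i + 1) s) + α i * z (i + 1) s| := by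
          rw [Real.norm_eq_abs]; ring_nf
      _ ≤ C * (N * ‖x s‖) + b * ((1 + C' * N) * ‖x s‖) :=
          (abs_add_le _ _).trans (add_le_add
            ((h3 i i.2).trans (by have := hsum (i + 1) (by omega) s; gcongr)) e1)
      _ = _ := by ring
  intro l hl
  have := hz l hl t
  rw [hzero t ⟨ht, le_rfl⟩, norm_zero, mul_zero] at this
  exact abs_nonpos_iff.1 this

/-- If the last function is controlled by the others, the common zeros form an invariant set. -/
theorem eq_zero (h : IsIntegratorChain N a b C z) (ha : 0 < a) (hC : 0 ≤ C) {C' : ℝ}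
    (hC' : 0 ≤ C') (hN : ∀ t, |z N t| ≤ C' * ∑ l ∈ Finset.range N, |z l t|) {t₀ : ℝ}
    (h0 : ∀ l < N, z l t₀ = 0) (t : ℝ) : ∀ l ≤ N, z l t = 0 := by
  rcases le_total t₀ t with ht | ht
  · exact h.eq_zero_of_le ha hC hC' hN h0 ht
  · intro l hl
    have := h.comp_neg.eq_zero_of_le ha hC hC' (t₀ := -t₀) (t := -t)
      (fun s => by simpa [abs_mul] using hN (-s)) (fun l hl => by simp [h0 l hl])
      (neg_le_neg ht) l hl
    simpa using this

end IsIntegratorChain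

/-! ### Lie derivatives of the output along Filippov solutions. -/

namespace BimodalSystem

variable {n : ℕ}

/-- The row vector `cᵀ Aʲ` of mode `i`. -/
def obsRow (S : BimodalSystem n) (i : Fin 2) (j : ℕ) : Fin n → ℝ :=
  S.c ᵥ* S.A i ^ j

/-- The entries `f, cᵀ e, cᵀ A e, …` of `E i`. -/
def obsOffset (S : BimodalSystem n) (i : Fin 2) : ℕ → ℝ
  | 0 => S.f
  | j + 1 => S.c ⬝ᵥ (S.A i ^ j *ᵥ S.e i)

/-- The `j`-th Lie derivative of the output along mode `i`. -/
def lie (S : BimodalSystem n) (i : Fin 2) (j : ℕ) (ξ : Fin n → ℝ) : ℝ :=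
  S.obsRow i j ⬝ᵥ ξ + S.obsOffset i j

theorem E_apply (S : BimodalSystem n) (i : Fin 2) (k : ℕ) (j : Fin (k + 1)) :
    S.E i k j = S.obsOffset i j := by
  refine Fin.cases rfl (fun j => ?_) j
  simp [E, obsOffset]

theorem T_mulVec_add_E (S : BimodalSystem n) (i : Fin 2) (k : ℕ) (ξ : Fin n → ℝ)
    (j : Fin (k + 1)) : (S.T i k *ᵥ ξ + S.E i k) j = S.lie i j ξ := by
  rw [Pi.add_apply, E_apply]; rfl

theorem lie_zero (S : BimodalSystem n) (i : Fin 2) (ξ : Fin n → ℝ) :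
    S.lie i 0 ξ = S.output ξ := by
  simp [lie, obsRow, obsOffset, output]

/-- The chain rule: differentiating `lie i j` along mode `i` gives `lie i (j + 1)`. -/
theorem lie_succ (S : BimodalSystem n) (i : Fin 2) (j : ℕ) (ξ : Fin n → ℝ) :
    S.lie i (j + 1) ξ = S.obsRow i j ⬝ᵥ S.mode i ξ := by
  simp only [lie, obsRow, obsOffset, mode, dotProduct_add, ← dotProduct_mulVec, pow_succ,
    ← mulVec_mulVec]

theorem T_mulVec_add_E_eq_zero (S : BimodalSystem n) (i : Fin 2) (k : ℕ) (ξ : Fin n → ℝ) :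
    S.T i k *ᵥ ξ + S.E i k = 0 ↔ ∀ l ≤ k, S.lie i l ξ = 0 := by
  rw [funext_iff]
  simp only [T_mulVec_add_E, Pi.zero_apply]
  exact ⟨fun h l hl => h ⟨l, by omega⟩, fun h j => h j (by omega)⟩

/-- Up to order `N` the Lie derivatives of the output along the first mode are obtained from
those along the second mode by a lower triangular matrix with positive diagonal. -/
def LieTriangular (S : BimodalSystem n) (N : ℕ) : Prop :=
  ∃ (μ : ℕ → ℝ) (m : ℕ → ℕ → ℝ), ∀ j ≤ N, 0 < μ j ∧ ∀ ξ, S.lie 0 j ξ =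
    μ j * S.lie 1 j ξ + ∑ l ∈ Finset.range j, m j l * S.lie 1 l ξ

theorem lieTriangular_of_isLowerPos {S : BimodalSystem n} {N : ℕ}
    {M : Matrix (Fin (N + 1)) (Fin (N + 1)) ℝ} (hM : IsLowerPos M)
    (hT : S.T 0 N = M * S.T 1 N) (hE : S.E 0 N = M *ᵥ S.E 1 N) : S.LieTriangular N := by
  set m : ℕ → ℕ → ℝ := fun j l => if h : j < N + 1 ∧ l < N + 1 then M ⟨j, h.1⟩ ⟨l, h.2⟩ else 0
    with hm
  refine ⟨fun j => m j j, m, fun j hj => ⟨?_, fun ξ => ?_⟩⟩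
  all_goals beta_reduce
  · simpa [hm, hj] using hM.2 ⟨j, by omega⟩
  · have h1 : S.T 0 N *ᵥ ξ + S.E 0 N = M *ᵥ (S.T 1 N *ᵥ ξ + S.E 1 N) := by
      rw [mulVec_add, mulVec_mulVec, ← hT, ← hE]
    have h2 := congrFun h1 ⟨j, by omega⟩
    rw [T_mulVec_add_E] at h2
    simp only [mulVec, dotProduct, T_mulVec_add_E] at h2
    have h3 : ∑ l : Fin (N + 1), M ⟨j, by omega⟩ l * S.lie 1 l ξ =
        ∑ l ∈ Finset.range (N + 1), m j l * S.lie 1 l ξ := by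
      rw [← Fin.sum_univ_eq_sum_range (fun l => m j l * S.lie 1 l ξ)]
      refine Finset.sum_congr rfl fun l _ => ?_
      simp only [hm, dif_pos (show j < N + 1 ∧ (l : ℕ) < N + 1 from ⟨by omega, l.2⟩)]
    rw [h2, h3, add_comm (m j j * _), ← Finset.sum_range_succ (fun l => m j l * S.lie 1 l ξ)]
    refine (Finset.sum_subset (Finset.range_mono (by omega)) fun l hl hl' => ?_).symm
    have hlN := Finset.mem_range.1 hl
    have hjl : j < l := by simpa using hl'
    have : m j l = 0 := by
      simp only [hm, dif_pos (show j < N + 1 ∧ l < N + 1 from ⟨by omega, hlN⟩)]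
      exact hM.1 _ _ hjl
    rw [this, zero_mul]

theorem LieTriangular.lie_zero_eq_zero {S : BimodalSystem n} {N : ℕ} (h : S.LieTriangular N)
    {ξ : Fin n → ℝ} (h1 : ∀ l ≤ N, S.lie 1 l ξ = 0) : ∀ l ≤ N, S.lie 0 l ξ = 0 := by
  obtain ⟨μ, m, h⟩ := h
  intro l hl
  rw [(h l hl).2, h1 l hl, mul_zero, zero_add]
  refine Finset.sum_eq_zero fun i hi => ?_
  rw [h1 i (by have := Finset.mem_range.1 hi; omega), mul_zero]

/-- Forward substitution, using that the diagonal entries are nonzero. -/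
theorem LieTriangular.lie_one_eq_zero {S : BimodalSystem n} {N : ℕ} (h : S.LieTriangular N)
    {ξ : Fin n → ℝ} (h0 : ∀ l ≤ N, S.lie 0 l ξ = 0) : ∀ l ≤ N, S.lie 1 l ξ = 0 := by
  obtain ⟨μ, m, h⟩ := h
  intro l
  induction l using Nat.strong_induction_on with
  | _ l ih =>
    intro hl
    have h1 := (h l hl).2 ξ
    rw [h0 l hl, Finset.sum_eq_zero fun i hi => by
      have := Finset.mem_range.1 hi
      rw [ih i this (by omega), mul_zero], add_zero] at h1
    exact (mul_eq_zero.1 h1.symm).resolve_left (h l hl).1.ne'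

/-- The linear part of an identity between affine functions, obtained by subtracting its value at
`0`. -/
theorem obsRow_dotProduct_of_lie {S : BimodalSystem n} {μ : ℕ → ℝ}
    {m : ℕ → ℕ → ℝ} {j : ℕ} (h : ∀ ξ, S.lie 0 j ξ =
      μ j * S.lie 1 j ξ + ∑ l ∈ Finset.range j, m j l * S.lie 1 l ξ) (v : Fin n → ℝ) :
    S.obsRow 0 j ⬝ᵥ v =
      μ j * (S.obsRow 1 j ⬝ᵥ v) + ∑ l ∈ Finset.range j, m j l * (S.obsRow 1 l ⬝ᵥ v) := by
  have h1 := h v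
  have h0 := h 0
  simp only [lie, mul_add, Finset.sum_add_distrib, dotProduct_zero, zero_add] at h1 h0
  linarith

/-- The derivatives along the first mode of the Lie derivatives along the second mode. -/
theorem LieTriangular.exists_cross_bound {S : BimodalSystem n} {N : ℕ} (h : S.LieTriangular N)
    (j : ℕ) (hj : j < N) : ∃ α > 0, ∃ C ≥ 0, ∀ ξ,
      |S.obsRow 1 j ⬝ᵥ S.mode 0 ξ - α * S.lie 1 (j + 1) ξ| ≤
        C * ∑ l ∈ Finset.range (j + 1), |S.lie 1 l ξ| := by
  obtain ⟨μ, m, h⟩ := h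
  induction j using Nat.strong_induction_on with
  | _ j ih =>
    choose! α hα C hC hb using fun l hl => ih l hl (by omega)
    have hμ := (h j hj.le).1
    -- Differentiating the relation of order `j` along mode `0` gives `lie 0 (j + 1)`, which the
    -- relation of order `j + 1` also expresses. Comparing the leading terms gives the ratio of
    -- diagonal entries; the lower cross derivatives are bounded by induction.
    refine ⟨μ (j + 1) / μ j, div_pos (h (j + 1) hj).1 hμ,
      (∑ l ∈ Finset.range (j + 1), |m (j + 1) l| +
        ∑ l ∈ Finset.range j, |m j l| * (α l + C l)) / μ j, ?_, fun ξ => ?_⟩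
    · refine div_nonneg (add_nonneg (Finset.sum_nonneg fun _ _ => abs_nonneg _)
        (Finset.sum_nonneg fun l hl => ?_)) hμ.le
      have hl := Finset.mem_range.1 hl
      exact mul_nonneg (abs_nonneg _) (add_nonneg (hα l hl).le (hC l hl))
    · set s := ∑ l ∈ Finset.range (j + 1), |S.lie 1 l ξ| with hs
      have hle : ∀ l ≤ j, |S.lie 1 l ξ| ≤ s := fun l hl =>
        Finset.single_le_sum (f := fun l => |S.lie 1 l ξ|) (fun _ _ => abs_nonneg _)
          (Finset.mem_range.2 (by omega))
      have hs0 : 0 ≤ s := Finset.sum_nonneg fun _ _ => abs_nonneg _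
      have hr : ∀ l < j, |S.obsRow 1 l ⬝ᵥ S.mode 0 ξ| ≤ (α l + C l) * s := by
        intro l hl
        have h1 : |α l * S.lie 1 (l + 1) ξ| ≤ α l * s := by
          rw [abs_mul, abs_of_pos (hα l hl)]
          exact mul_le_mul_of_nonneg_left (hle _ hl) (hα l hl).le
        have h2 : ∑ i ∈ Finset.range (l + 1), |S.lie 1 i ξ| ≤ s :=
          Finset.sum_le_sum_of_subset_of_nonneg (Finset.range_mono (by omega))
            fun _ _ _ => abs_nonneg _
        calc |S.obsRow 1 l ⬝ᵥ S.mode 0 ξ|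
            = |(S.obsRow 1 l ⬝ᵥ S.mode 0 ξ - α l * S.lie 1 (l + 1) ξ) +
                α l * S.lie 1 (l + 1) ξ| := by ring_nf
          _ ≤ C l * s + α l * s := (abs_add_le _ _).trans (add_le_add
              ((hb l hl ξ).trans (mul_le_mul_of_nonneg_left h2 (hC l hl))) h1)
          _ = _ := by ring
      have e1 := obsRow_dotProduct_of_lie (h j hj.le).2 (S.mode 0 ξ)
      rw [← lie_succ, (h (j + 1) hj).2] at e1
      have e2 : S.obsRow 1 j ⬝ᵥ S.mode 0 ξ - μ (j + 1) / μ j * S.lie 1 (j + 1) ξ =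
          (∑ l ∈ Finset.range (j + 1), m (j + 1) l * S.lie 1 l ξ -
            ∑ l ∈ Finset.range j, m j l * (S.obsRow 1 l ⬝ᵥ S.mode 0 ξ)) / μ j := by
        field_simp
        linarith
      rw [e2, abs_div, abs_of_pos hμ, div_mul_eq_mul_div, add_mul, Finset.sum_mul, Finset.sum_mul]
      gcongr
      refine (abs_sub _ _).trans (add_le_add ?_ ?_)
      · refine (Finset.abs_sum_le_sum_abs _ _).trans (Finset.sum_le_sum fun l hl => ?_)
        rw [abs_mul]
        exact mul_le_mul_of_nonneg_left (hle l (by have := Finset.mem_range.1 hl; omega))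
          (abs_nonneg _)
      · refine (Finset.abs_sum_le_sum_abs _ _).trans (Finset.sum_le_sum fun l hl => ?_)
        rw [abs_mul, mul_assoc]
        exact mul_le_mul_of_nonneg_left (hr l (Finset.mem_range.1 hl)) (abs_nonneg _)

theorem continuous_mode (S : BimodalSystem n) (i : Fin 2) : Continuous (S.mode i) := by
  unfold mode; fun_prop

theorem continuous_output (S : BimodalSystem n) : Continuous S.output := by
  unfold output; fun_prop

theorem exists_of_mem_convexRhs {S : BimodalSystem n} {x v : Fin n → ℝ}
    (hv : v ∈ S.convexRhs x) :
    ∃ θ ∈ Icc (0 : ℝ) 1, v = (1 - θ) • S.mode 0 x + θ • S.mode 1 x := by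
  unfold convexRhs at hv
  split_ifs at hv
  · exact ⟨0, by simp, by simpa using hv⟩
  · rw [convexHull_pair, segment_eq_image] at hv
    obtain ⟨θ, h1, h2⟩ := hv
    exact ⟨θ, h1, h2.symm⟩
  · exact ⟨1, by simp, by simpa using hv⟩

theorem AbsCont.continuous {x : ℝ → Fin n → ℝ} (hx : AbsCont x) : Continuous x := by
  refine continuous_iff_continuousAt.2 fun t => ?_
  refine (hx (t - 1) (t + 1)).continuousOn.continuousAt ?_
  rw [uIcc_of_le (by linarith)]
  exact Icc_mem_nhds (by linarith) (by linarith)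

/-- Velocities are convex combinations of the two continuous modes along a continuous curve, hence
bounded on compact intervals. -/
theorem IsFilippov.locallyLipschitz {S : BimodalSystem n} {ξ : Fin n → ℝ} {x : ℝ → Fin n → ℝ}
    (hx : S.IsFilippov ξ x) : LocallyLipschitz x := by
  intro t
  have hc := hx.1.continuous
  have hcm := fun i => (S.continuous_mode i).comp hc
  obtain ⟨B, hB⟩ := (isCompact_Icc (a := t - 1) (b := t + 1)).exists_bound_of_continuousOn
    ((hcm 0).norm.add (hcm 1).norm).continuousOn
  have hB0 : 0 ≤ B := (norm_nonneg _).trans (hB t ⟨by linarith, by linarith⟩)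
  have key : ∀ p ∈ Icc (t - 1) (t + 1), ∀ q ∈ Icc (t - 1) (t + 1), p ≤ q →
      dist (x p) (x q) ≤ B * dist p q := by
    intro p hp q hq hpq
    have := (hx.1 p q).norm_sub_le_integral (g := fun _ => B) hpq continuousOn_const (by
      filter_upwards [hx.2.2] with s hs hsm
      obtain ⟨v, hv, hd⟩ := hs
      refine ⟨v, ?_, hd⟩
      obtain ⟨θ, hθ, rfl⟩ := exists_of_mem_convexRhs hv
      have h1 := hB s ⟨hp.1.trans hsm.1.le, hsm.2.le.trans hq.2⟩
      refine (norm_add_le _ _).trans (le_trans ?_ ((le_abs_self _).trans h1))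
      rw [norm_smul, norm_smul, Real.norm_of_nonneg hθ.1,
        Real.norm_of_nonneg (sub_nonneg.2 hθ.2)]
      refine add_le_add ?_ ?_
      · exact mul_le_of_le_one_left (norm_nonneg _) (by linarith [hθ.1])
      · exact mul_le_of_le_one_left (norm_nonneg _) hθ.2) (fun _ _ => hB0)
    rw [dist_comm, dist_eq_norm, dist_comm, Real.dist_eq, abs_of_nonneg (sub_nonneg.2 hpq)]
    refine this.trans_eq ?_
    simp [mul_comm]
  refine ⟨⟨B, hB0⟩, Icc (t - 1) (t + 1), Icc_mem_nhds (by linarith) (by linarith),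
    LipschitzOnWith.of_dist_le_mul fun p hp q hq => ?_⟩
  rcases le_total p q with h | h
  · exact key p hp q hq h
  · rw [dist_comm, dist_comm p]
    exact key q hq p hp h

theorem hasDerivAt_dotProduct {x : ℝ → Fin n → ℝ} {v : Fin n → ℝ} {t : ℝ}
    (hx : HasDerivAt x v t) (w : Fin n → ℝ) : HasDerivAt (fun s => w ⬝ᵥ x s) (w ⬝ᵥ v) t := by
  simp only [dotProduct]
  exact HasDerivAt.fun_sum fun i _ => (hasDerivAt_pi.1 hx i).const_mul (w i)

/-- For a velocity of weight `θ`, the derivative of `lie 1 i` is, up to lower terms, `(1 - θ) * α i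
+ θ` times `lie 1 (i + 1)`. This gain stays positive even on sliding arcs. -/
theorem IsFilippov.exists_isIntegratorChain {S : BimodalSystem n} {N : ℕ}
    (hS : S.LieTriangular N) {ξ : Fin n → ℝ} {x : ℝ → Fin n → ℝ} (hx : S.IsFilippov ξ x) :
    ∃ a b C, 0 < a ∧ 0 ≤ C ∧ IsIntegratorChain N a b C (fun i t => S.lie 1 i (x t)) := by
  choose! α hα C hC hb using hS.exists_cross_bound
  have hα' : ∀ i ∈ Finset.range N, 0 ≤ α i := fun i hi => (hα i (Finset.mem_range.1 hi)).le
  have hinv : ∀ i ∈ Finset.range N, 0 ≤ (α i)⁻¹ := fun i hi => inv_nonneg.2 (hα' i hi)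
  have hC' : ∀ i ∈ Finset.range N, 0 ≤ C i := fun i hi => hC i (Finset.mem_range.1 hi)
  have hpos : 0 < 1 + ∑ i ∈ Finset.range N, (α i)⁻¹ :=
    add_pos_of_pos_of_nonneg one_pos (Finset.sum_nonneg hinv)
  -- The lower constant is at most `1` and every `α i`, the upper one at least these, so both bound
  -- every convex combination of `1` and `α i`.
  refine ⟨(1 + ∑ i ∈ Finset.range N, (α i)⁻¹)⁻¹, 1 + ∑ i ∈ Finset.range N, α i,
    ∑ i ∈ Finset.range N, C i, inv_pos.2 hpos, Finset.sum_nonneg hC', fun i => ?_, ?_⟩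
  · refine LocallyLipschitz.comp (f := S.lie 1 i) ?_ hx.locallyLipschitz
    refine ContDiff.locallyLipschitz (𝕂 := ℝ) ?_
    unfold lie dotProduct
    fun_prop
  · filter_upwards [hx.2.2] with t ht i hi
    obtain ⟨v, hv, hd⟩ := ht
    obtain ⟨θ, hθ, rfl⟩ := exists_of_mem_convexRhs hv
    have hi' := Finset.mem_range.2 hi
    have h1 : (1 + ∑ i ∈ Finset.range N, (α i)⁻¹)⁻¹ ≤ 1 :=
      inv_le_one_of_one_le₀ (by linarith [Finset.sum_nonneg hinv])
    have h2 : (1 + ∑ i ∈ Finset.range N, (α i)⁻¹)⁻¹ ≤ α i := by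
      rw [inv_le_comm₀ hpos (hα i hi)]
      linarith [Finset.single_le_sum hinv hi']
    have h3 := Finset.single_le_sum hα' hi'
    have h4 := Finset.sum_nonneg hα'
    refine ⟨_, (1 - θ) * α i + θ, (hasDerivAt_dotProduct hd (S.obsRow 1 i)).add_const _, ?_, ?_, ?_⟩
    · nlinarith [hθ.1, hθ.2]
    · nlinarith [hθ.1, hθ.2]
    · rw [dotProduct_add, dotProduct_smul, dotProduct_smul, ← lie_succ, smul_eq_mul, smul_eq_mul,
        show ∀ r w : ℝ, (1 - θ) * r + θ * w - ((1 - θ) * α i + θ) * w =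
          (1 - θ) * (r - α i * w) by intros; ring, abs_mul, abs_of_nonneg (sub_nonneg.2 hθ.2)]
      refine (mul_le_of_le_one_left (abs_nonneg _) (by linarith [hθ.1])).trans
        ((hb i hi (x t)).trans ?_)
      gcongr
      exact Finset.single_le_sum hC' hi'

/-! ### Regular systems: regularity and uniqueness of solutions. -/

/-- The property of the two modes that makes all Filippov solutions regular. -/
structure IsRegular (S : BimodalSystem n) (N : ℕ) : Prop where
  lieTriangular : S.LieTriangular N
  obsRow_mem : ∃ p : ℕ → ℝ, S.obsRow 1 N = ∑ l ∈ Finset.range N, p l • S.obsRow 1 l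
  mode_eq : ∀ ξ, (∀ l ≤ N, S.lie 1 l ξ = 0) → S.mode 0 ξ = S.mode 1 ξ

/-- Measured from a common zero `ξ₀`, the affine functions `lie 1 l` become linear in `ξ - ξ₀`, so
the dependence of the rows passes to them. -/
theorem IsRegular.exists_abs_lie_le {S : BimodalSystem n} {N : ℕ} (hS : S.IsRegular N)
    {ξ₀ : Fin n → ℝ} (h0 : ∀ l ≤ N, S.lie 1 l ξ₀ = 0) :
    ∃ C ≥ 0, ∀ ξ, |S.lie 1 N ξ| ≤ C * ∑ l ∈ Finset.range N, |S.lie 1 l ξ| := by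
  obtain ⟨p, hp⟩ := hS.obsRow_mem
  have hdiff : ∀ l ≤ N, ∀ ξ, S.lie 1 l ξ = S.obsRow 1 l ⬝ᵥ (ξ - ξ₀) := by
    intro l hl ξ
    have := h0 l hl
    unfold lie at this ⊢
    rw [dotProduct_sub]; linarith
  refine ⟨∑ l ∈ Finset.range N, |p l|, Finset.sum_nonneg fun _ _ => abs_nonneg _, fun ξ => ?_⟩
  rw [hdiff N le_rfl, hp, sum_dotProduct, Finset.sum_mul]
  refine (Finset.abs_sum_le_sum_abs _ _).trans (Finset.sum_le_sum fun l hl => ?_)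
  rw [smul_dotProduct, smul_eq_mul, abs_mul,
    ← hdiff l (Finset.mem_range.1 hl).le]
  gcongr
  exact Finset.single_le_sum (f := fun l => |S.lie 1 l ξ|) (fun _ _ => abs_nonneg _) hl

theorem IsRegular.lie_eq_zero {S : BimodalSystem n} {N : ℕ} (hS : S.IsRegular N)
    {ξ : Fin n → ℝ} {x : ℝ → Fin n → ℝ} (hx : S.IsFilippov ξ x) {t₀ : ℝ}
    (h0 : ∀ l ≤ N, S.lie 1 l (x t₀) = 0) (t : ℝ) : ∀ l ≤ N, S.lie 1 l (x t) = 0 := by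
  obtain ⟨a, b, C, ha, hC, hchain⟩ := hx.exists_isIntegratorChain hS.lieTriangular
  obtain ⟨C', hC', hb⟩ := hS.exists_abs_lie_le h0
  exact hchain.eq_zero ha hC hC' (fun t => hb (x t)) (fun l hl => h0 l hl.le) t

theorem convexRhs_of_mode_eq {S : BimodalSystem n} {x : Fin n → ℝ}
    (h : S.mode 0 x = S.mode 1 x) (i : Fin 2) : S.convexRhs x = {S.mode i x} := by
  have : S.mode i x = S.mode 1 x := by fin_cases i; exacts [h, rfl]
  unfold convexRhs
  rw [this, h]
  simp

theorem IsRegular.hasDerivAt {S : BimodalSystem n} {N : ℕ} (hS : S.IsRegular N)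
    {ξ : Fin n → ℝ} {x : ℝ → Fin n → ℝ} (hx : S.IsFilippov ξ x)
    (h0 : ∀ t, ∀ l ≤ N, S.lie 1 l (x t) = 0) (i : Fin 2) (t : ℝ) :
    HasDerivAt x (S.mode i (x t)) t := by
  refine hx.locallyLipschitz.hasDerivAt_of_ae (a := t - 1) (b := t + 1)
    ((S.continuous_mode i).comp hx.1.continuous) ?_ t ⟨by linarith, by linarith⟩
  filter_upwards [hx.2.2] with s hs _
  obtain ⟨v, hv, hd⟩ := hs
  rw [convexRhs_of_mode_eq (hS.mode_eq _ (h0 s)) i, mem_singleton_iff] at hv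
  rwa [hv] at hd

theorem IsFilippov.obeysMode_zero {S : BimodalSystem n} {ξ : Fin n → ℝ} {x : ℝ → Fin n → ℝ}
    (hx : S.IsFilippov ξ x) {a b : ℝ} (h : ∀ t ∈ Ioo a b, S.output (x t) < 0) :
    ∀ t ∈ Ioo a b, S.ObeysMode x 0 t := by
  intro t ht
  refine ⟨?_, by simpa using (h t ht).le⟩
  refine hx.locallyLipschitz.hasDerivAt_of_ae
    ((S.continuous_mode 0).comp hx.1.continuous) ?_ t ht
  filter_upwards [hx.2.2] with s hs hsm
  obtain ⟨v, hv, hd⟩ := hs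
  rw [convexRhs, if_pos (h s hsm), mem_singleton_iff] at hv
  rwa [hv] at hd

theorem IsFilippov.obeysMode_one {S : BimodalSystem n} {ξ : Fin n → ℝ} {x : ℝ → Fin n → ℝ}
    (hx : S.IsFilippov ξ x) {a b : ℝ} (h : ∀ t ∈ Ioo a b, 0 < S.output (x t)) :
    ∀ t ∈ Ioo a b, S.ObeysMode x 1 t := by
  intro t ht
  refine ⟨?_, by simpa using (h t ht).le⟩
  refine hx.locallyLipschitz.hasDerivAt_of_ae
    ((S.continuous_mode 1).comp hx.1.continuous) ?_ t ht
  filter_upwards [hx.2.2] with s hs hsm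
  obtain ⟨v, hv, hd⟩ := hs
  rw [convexRhs, if_neg (h s hsm).not_gt, if_neg (h s hsm).ne', mem_singleton_iff] at hv
  rwa [hv] at hd

theorem IsRegular.eventually_sign {S : BimodalSystem n} {N : ℕ} (hS : S.IsRegular N)
    {ξ : Fin n → ℝ} {x : ℝ → Fin n → ℝ} (hx : S.IsFilippov ξ x) {t₀ : ℝ}
    (hne : ¬∀ l ≤ N, S.lie 1 l (x t₀) = 0) :
    ((∀ᶠ t in 𝓝[>] t₀, 0 < S.output (x t)) ∨ ∀ᶠ t in 𝓝[>] t₀, S.output (x t) < 0) ∧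
    ((∀ᶠ t in 𝓝[<] t₀, 0 < S.output (x t)) ∨ ∀ᶠ t in 𝓝[<] t₀, S.output (x t) < 0) := by
  obtain ⟨a, b, C, ha, hC, hchain⟩ := hx.exists_isIntegratorChain hS.lieTriangular
  simpa only [lie_zero] using hchain.eventually_sign ha hC hne

theorem IsRegular.eventually_output_pos {S : BimodalSystem n} {N : ℕ} (hS : S.IsRegular N)
    {ξ : Fin n → ℝ} {x : ℝ → Fin n → ℝ} (hx : S.IsFilippov ξ x) {t₀ : ℝ} {j : ℕ} (hj : j ≤ N)
    (h0 : ∀ l < j, S.lie 1 l (x t₀) = 0) (hpos : 0 < S.lie 1 j (x t₀)) :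
    ∀ᶠ t in 𝓝[>] t₀, 0 < S.output (x t) := by
  obtain ⟨a, b, C, ha, hC, hchain⟩ := hx.exists_isIntegratorChain hS.lieTriangular
  simpa only [lie_zero] using hchain.eventually_pos_right ha hC hj h0 hpos

theorem IsRegular.eventually_output_neg {S : BimodalSystem n} {N : ℕ} (hS : S.IsRegular N)
    {ξ : Fin n → ℝ} {x : ℝ → Fin n → ℝ} (hx : S.IsFilippov ξ x) {t₀ : ℝ} {j : ℕ} (hj : j ≤ N)
    (h0 : ∀ l < j, S.lie 1 l (x t₀) = 0) (hneg : S.lie 1 j (x t₀) < 0) :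
    ∀ᶠ t in 𝓝[>] t₀, S.output (x t) < 0 := by
  obtain ⟨a, b, C, ha, hC, hchain⟩ := hx.exists_isIntegratorChain hS.lieTriangular
  simpa only [lie_zero] using hchain.eventually_neg_right ha hC hj h0 hneg

theorem exists_forall_Ioo_right {p : ℝ → Prop} {t : ℝ} (h : ∀ᶠ s in 𝓝[>] t, p s) :
    ∃ ε > 0, ∀ s ∈ Ioo t (t + ε), p s := by
  obtain ⟨u, hu, hs⟩ := mem_nhdsGT_iff_exists_Ioo_subset.1 h
  exact ⟨u - t, sub_pos.2 hu, fun s hsm => hs ⟨hsm.1, by linarith [hsm.2]⟩⟩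

theorem exists_forall_Ioo_left {p : ℝ → Prop} {t : ℝ} (h : ∀ᶠ s in 𝓝[<] t, p s) :
    ∃ ε > 0, ∀ s ∈ Ioo (t - ε) t, p s := by
  obtain ⟨u, hu, hs⟩ := mem_nhdsLT_iff_exists_Ioo_subset.1 h
  exact ⟨t - u, sub_pos.2 hu, fun s hsm => hs ⟨by linarith [hsm.1], hsm.2⟩⟩

/-- `rhs` and `convexRhs` differ only at zero output, and there almost surely all Lie derivatives
vanish, so that the modes agree. -/
theorem IsRegular.isCaratheodory {S : BimodalSystem n} {N : ℕ} (hS : S.IsRegular N)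
    {ξ : Fin n → ℝ} {x : ℝ → Fin n → ℝ} (hx : S.IsFilippov ξ x) : S.IsCaratheodory ξ x := by
  refine ⟨hx.1, hx.2.1, ?_⟩
  -- The exceptional times are isolated, since the output has a strict sign on both sides of each;
  -- so they form a null set.
  have hnull : ∀ᵐ t, S.output (x t) = 0 → ∀ l ≤ N, S.lie 1 l (x t) = 0 := by
    rw [ae_iff]
    refine measure_null_of_locally_null _ fun t ht => ⟨{t}, ?_, by simp⟩
    simp only [mem_ofPred_eq, Classical.not_imp] at ht
    have hs := hS.eventually_sign hx ht.2
    have h0 : ∀ᶠ s in 𝓝[≠] t, S.output (x s) ≠ 0 := by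
      rw [← Iio_union_Ioi, nhdsWithin_union, eventually_sup]
      exact ⟨hs.2.elim (fun h => h.mono fun _ h => h.ne') (fun h => h.mono fun _ h => h.ne),
        hs.1.elim (fun h => h.mono fun _ h => h.ne') (fun h => h.mono fun _ h => h.ne)⟩
    rw [eventually_nhdsWithin_iff] at h0
    rw [mem_nhdsWithin_iff_eventually]
    filter_upwards [h0] with s hs hsm
    by_contra hne
    simp only [Classical.not_imp] at hsm
    exact hs hne hsm.1
  filter_upwards [hx.2.2, hnull] with t ht hz
  obtain ⟨v, hv, hd⟩ := ht
  refine ⟨v, ?_, hd⟩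
  by_cases h0 : S.output (x t) = 0
  · rw [convexRhs_of_mode_eq (hS.mode_eq _ (hz h0)) 0] at hv
    simp [rhs, h0, mem_singleton_iff.1 hv]
  · simpa [rhs, convexRhs, h0] using hv

/-- Dichotomy: a common zero at one time persists for all times, and then mode `0` is obeyed
throughout; otherwise the output has a strict sign on either side of every time. -/
theorem IsRegular.filippovIsCaratheodory {S : BimodalSystem n} {N : ℕ} (hS : S.IsRegular N) :
    S.FilippovIsCaratheodory := by
  intro ξ x hx
  have hcar := hS.isCaratheodory hx
  by_cases h0 : ∃ t, ∀ l ≤ N, S.lie 1 l (x t) = 0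
  · obtain ⟨t₀, h0⟩ := h0
    have h := hS.lie_eq_zero hx h0
    have hob : ∀ t, S.ObeysMode x 0 t := fun t =>
      ⟨hS.hasDerivAt hx h 0 t, by rw [← S.lie_zero 1, h t 0 (Nat.zero_le _), mul_zero]⟩
    exact ⟨⟨hcar, fun s => ⟨0, 1, one_pos, fun t _ => hob t⟩⟩,
      ⟨hcar, fun s => ⟨0, 1, one_pos, fun t _ => hob t⟩⟩⟩
  · simp only [not_exists] at h0
    refine ⟨⟨hcar, fun s => ?_⟩, ⟨hcar, fun s => ?_⟩⟩
    · rcases (hS.eventually_sign hx (h0 s)).1 with h | h <;>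
        obtain ⟨ε, hε, h⟩ := exists_forall_Ioo_right h
      · exact ⟨1, ε, hε, hx.obeysMode_one h⟩
      · exact ⟨0, ε, hε, hx.obeysMode_zero h⟩
    · rcases (hS.eventually_sign hx (h0 s)).2 with h | h <;>
        obtain ⟨ε, hε, h⟩ := exists_forall_Ioo_left h
      · exact ⟨1, ε, hε, hx.obeysMode_one h⟩
      · exact ⟨0, ε, hε, hx.obeysMode_zero h⟩

theorem exists_mode_sub_le (S : BimodalSystem n) (i : Fin 2) :
    ∃ K ≥ 0, ∀ x y, ‖S.mode i x - S.mode i y‖ ≤ K * ‖x - y‖ := by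
  refine ⟨_, norm_nonneg (Matrix.mulVecLin (S.A i)).toContinuousLinearMap, fun x y => ?_⟩
  have := (Matrix.mulVecLin (S.A i)).toContinuousLinearMap.le_opNorm (x - y)
  simpa [mode, mulVec_sub] using this

theorem eq_of_hasDerivAt_mode {S : BimodalSystem n} {i : Fin 2} {x y : ℝ → Fin n → ℝ} {a b : ℝ}
    (hx : LocallyLipschitz x) (hy : LocallyLipschitz y) (h0 : x a = y a)
    (hxd : ∀ t ∈ Ioo a b, HasDerivAt x (S.mode i (x t)) t)
    (hyd : ∀ t ∈ Ioo a b, HasDerivAt y (S.mode i (y t)) t) :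
    ∀ t ∈ Ico a b, x t = y t := by
  intro t ht
  obtain ⟨K, hK0, hK⟩ := S.exists_mode_sub_le i
  have := ((hx.absolutelyContinuousOnInterval a b).fun_sub
    (hy.absolutelyContinuousOnInterval a b)).eq_zero_of_norm_deriv_le hK0
    (hx.continuous.sub hy.continuous)
    (ae_of_all _ fun s hs => ⟨_, hK (x s) (y s), (hxd s hs).fun_sub (hyd s hs)⟩)
    (sub_eq_zero.2 h0) t ⟨ht.1, ht.2.le⟩
  exact sub_eq_zero.1 this

/-- The first nonzero Lie derivative depends only on the initial state, so both solutions enter the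
same open half-space and solve the same affine equation there. At a common zero both solve the
equation of mode `0`. -/
theorem IsRegular.rightUniqueness {S : BimodalSystem n} {N : ℕ} (hS : S.IsRegular N) :
    S.RightUniqueness := by
  intro ξ x hx y hy
  have hxy : x 0 = y 0 := hx.2.1.trans hy.2.1.symm
  by_cases h0 : ∀ l ≤ N, S.lie 1 l (x 0) = 0
  · refine ⟨1, one_pos, ?_⟩
    exact eq_of_hasDerivAt_mode (i := 0) hx.locallyLipschitz hy.locallyLipschitz hxy
      (fun t _ => hS.hasDerivAt hx (hS.lie_eq_zero hx h0) 0 t)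
      (fun t _ => hS.hasDerivAt hy (hS.lie_eq_zero hy (hxy ▸ h0)) 0 t)
  · obtain ⟨j, hj, hlt, hne⟩ := exists_first_ne_zero (w := fun l => S.lie 1 l (x 0)) h0
    have hlt' : ∀ l < j, S.lie 1 l (y 0) = 0 := by rw [← hxy]; exact hlt
    rcases hne with hneg | hpos
    · obtain ⟨ε, hε, h⟩ := exists_forall_Ioo_right
        ((hS.eventually_output_neg hx hj hlt hneg).and
          (hS.eventually_output_neg hy hj hlt' (hxy ▸ hneg)))
      rw [zero_add] at h
      exact ⟨ε, hε, eq_of_hasDerivAt_mode (i := 0) hx.locallyLipschitz hy.locallyLipschitz hxy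
        (fun t ht => (hx.obeysMode_zero (fun t ht => (h t ht).1) t ht).1)
        (fun t ht => (hy.obeysMode_zero (fun t ht => (h t ht).2) t ht).1)⟩
    · obtain ⟨ε, hε, h⟩ := exists_forall_Ioo_right
        ((hS.eventually_output_pos hx hj hlt hpos).and
          (hS.eventually_output_pos hy hj hlt' (hxy ▸ hpos)))
      rw [zero_add] at h
      exact ⟨ε, hε, eq_of_hasDerivAt_mode (i := 1) hx.locallyLipschitz hy.locallyLipschitz hxy
        (fun t ht => (hx.obeysMode_one (fun t ht => (h t ht).1) t ht).1)
        (fun t ht => (hy.obeysMode_one (fun t ht => (h t ht).2) t ht).1)⟩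

end BimodalSystem

/-! ### The Euler scheme for discontinuous vector fields. -/

section Euler

variable {V : Type*} [NormedAddCommGroup V] [NormedSpace ℝ V]

/-- The explicit Euler scheme with step `δ` for the (arbitrary) vector field `g`. -/
def eulerSeq (g : V → V) (δ : ℝ) (ξ : V) : ℕ → V
  | 0 => ξ
  | j + 1 => eulerSeq g δ ξ j + δ • g (eulerSeq g δ ξ j)

/-- Discrete Grönwall: each step multiplies `1 + ‖y‖` by at most `1 + δ * K ≤ exp (K * δ)`. -/
theorem one_add_norm_eulerSeq_le {g : V → V} {K : ℝ}
    (hg : ∀ y, ‖g y‖ ≤ K * (1 + ‖y‖)) {δ : ℝ} (hδ : 0 ≤ δ) (ξ : V) (j : ℕ) :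
    1 + ‖eulerSeq g δ ξ j‖ ≤ Real.exp (K * (δ * j)) * (1 + ‖ξ‖) := by
  induction j with
  | zero => simp [eulerSeq]
  | succ j ih =>
    set p := eulerSeq g δ ξ j with hp
    have h1 : ‖p + δ • g p‖ ≤ ‖p‖ + δ * (K * (1 + ‖p‖)) := by
      refine (norm_add_le _ _).trans ?_
      rw [norm_smul, Real.norm_of_nonneg hδ]
      gcongr
      exact hg p
    have h2 : 1 + δ * K ≤ Real.exp (K * δ) := by
      linarith [Real.add_one_le_exp (K * δ)]
    have h3 : K * (δ * (j + 1 : ℕ)) = K * δ + K * (δ * j) := by push_cast; ring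
    rw [h3, Real.exp_add, mul_assoc]
    calc 1 + ‖p + δ • g p‖ ≤ (1 + δ * K) * (1 + ‖p‖) := by linarith
      _ ≤ _ := by gcongr

theorem eulerSeq_sub (g : V → V) (δ : ℝ) (ξ : V) {i j : ℕ} (hij : i ≤ j) :
    eulerSeq g δ ξ j - eulerSeq g δ ξ i =
      δ • ∑ l ∈ Finset.Ico i j, g (eulerSeq g δ ξ l) := by
  induction j, hij using Nat.le_induction with
  | base => simp
  | succ j hij ih =>
    rw [Finset.sum_Ico_succ_top hij, smul_add, ← ih, eulerSeq]
    abel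

theorem norm_eulerSeq_sub_le {g : V → V} {K : ℝ} (hK : 0 ≤ K)
    (hg : ∀ y, ‖g y‖ ≤ K * (1 + ‖y‖)) {δ T : ℝ} (hδ : 0 ≤ δ) (ξ : V) {i j : ℕ} (hij : i ≤ j)
    (hj : δ * j ≤ T) :
    ‖eulerSeq g δ ξ j - eulerSeq g δ ξ i‖ ≤
      K * (Real.exp (K * T) * (1 + ‖ξ‖)) * (δ * j - δ * i) := by
  rw [eulerSeq_sub g δ ξ hij, norm_smul, Real.norm_of_nonneg hδ]
  calc δ * ‖∑ l ∈ Finset.Ico i j, g (eulerSeq g δ ξ l)‖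
      ≤ δ * ∑ l ∈ Finset.Ico i j, K * (Real.exp (K * T) * (1 + ‖ξ‖)) := by
        gcongr
        refine (norm_sum_le _ _).trans (Finset.sum_le_sum fun l hl => (hg _).trans ?_)
        have hl' : (l : ℝ) ≤ j := by exact_mod_cast (Finset.mem_Ico.1 hl).2.le
        have h2 := one_add_norm_eulerSeq_le hg hδ ξ l
        have h3 : δ * l ≤ T := (mul_le_mul_of_nonneg_left hl' hδ).trans hj
        refine mul_le_mul_of_nonneg_left (h2.trans ?_) hK
        gcongr
    _ = _ := by
        rw [Finset.sum_const, Nat.card_Ico, nsmul_eq_mul, Nat.cast_sub hij]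
        ring

theorem tendsto_floor_mul_div (t : ℝ) :
    Tendsto (fun k : ℕ => ((k : ℝ) + 1)⁻¹ * (⌊t * ((k : ℝ) + 1)⌋₊ : ℝ)) atTop (𝓝 (max t 0)) := by
  have hk : Tendsto (fun k : ℕ => (k : ℝ) + 1) atTop atTop :=
    tendsto_atTop_add_const_right _ _ tendsto_natCast_atTop_atTop
  rcases le_total 0 t with ht | ht
  · rw [max_eq_left ht]
    refine ((tendsto_nat_floor_mul_div_atTop ht).comp hk).congr fun k => ?_
    simp [div_eq_inv_mul]
  · rw [max_eq_right ht]
    refine tendsto_const_nhds.congr fun k => ?_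
    rw [Nat.floor_of_nonpos (mul_nonpos_of_nonpos_of_nonneg ht (by positivity))]
    simp

theorem inv_mul_floor_le (t : ℝ) (k : ℕ) :
    ((k : ℝ) + 1)⁻¹ * (⌊t * ((k : ℝ) + 1)⌋₊ : ℝ) ≤ max t 0 := by
  rcases le_total 0 t with ht | ht
  · rw [max_eq_left ht, inv_mul_le_iff₀ (by positivity), mul_comm]
    exact Nat.floor_le (by positivity)
  · rw [Nat.floor_of_nonpos (mul_nonpos_of_nonpos_of_nonneg ht (by positivity))]
    simp

/-- A vector field of linear growth, without any continuity, has a forward solution in the sense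
of Krasovskii. -/
theorem exists_krasovskii_solution [FiniteDimensional ℝ V] {g : V → V} {K : ℝ} (hK : 0 ≤ K)
    (hg : ∀ y, ‖g y‖ ≤ K * (1 + ‖y‖)) (ξ : V) :
    ∃ x : ℝ → V, LocallyLipschitz x ∧ x 0 = ξ ∧ ∀ t > 0, ∀ v, HasDerivAt x v t →
      ∀ s : Set V, IsClosed s → Convex ℝ s → (∀ᶠ y in 𝓝 (x t), g y ∈ s) → v ∈ s := by
  set δ : ℕ → ℝ := fun k => ((k : ℝ) + 1)⁻¹ with hδ
  have hδ0 : ∀ k, 0 < δ k := fun k => by positivity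
  -- The number of Euler steps of size `δ k` up to time `t`; the natural floor makes it `0` for
  -- negative `t`, whence `max t 0` below.
  set M : ℝ → ℕ → ℕ := fun t k => ⌊t * ((k : ℝ) + 1)⌋₊ with hM
  set p : ℕ → ℕ → V := fun k => eulerSeq g (δ k) ξ with hp
  have hMle : ∀ t k, δ k * M t k ≤ max t 0 := inv_mul_floor_le
  have hMlim : ∀ t, Tendsto (fun k => δ k * M t k) (hyperfilter ℕ) (𝓝 (max t 0)) := fun t =>
    (tendsto_floor_mul_div t).mono_left Nat.hyperfilter_le_atTop
  have hMmono : ∀ {s t} k, s ≤ t → M s k ≤ M t k := fun k hst => by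
    simp only [hM]; gcongr
  -- Bounded sequences converge along an ultrafilter, so the limit curve exists at all times at
  -- once, without extracting subsequences.
  have hlim : ∀ t, ∃ y, Tendsto (fun k => p k (M t k)) (hyperfilter ℕ) (𝓝 y) := by
    intro t
    have : ∀ k, p k (M t k) ∈ Metric.closedBall (0 : V)
        (Real.exp (K * max t 0) * (1 + ‖ξ‖)) := fun k => by
      rw [mem_closedBall_zero_iff]
      have h1 := one_add_norm_eulerSeq_le hg (hδ0 k).le ξ (M t k)
      have h2 : Real.exp (K * (δ k * M t k)) * (1 + ‖ξ‖) ≤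
          Real.exp (K * max t 0) * (1 + ‖ξ‖) := by
        gcongr
        exact hMle t k
      have h3 : ‖p k (M t k)‖ ≤ 1 + ‖p k (M t k)‖ := by linarith
      exact h3.trans (h1.trans h2)
    have hcomp : IsCompact (Metric.closedBall (0 : V) (Real.exp (K * max t 0) * (1 + ‖ξ‖))) := by
      have := FiniteDimensional.proper ℝ V
      exact isCompact_closedBall _ _
    obtain ⟨y, -, hy⟩ := hcomp.ultrafilter_le_nhds
      ((hyperfilter ℕ).map fun k => p k (M t k)) (by
        rw [le_principal_iff]
        exact Eventually.of_forall (f := (hyperfilter ℕ : Filter ℕ)) this)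
    exact ⟨y, hy⟩
  choose x hx using hlim
  set B : ℝ → ℝ := fun T => K * (Real.exp (K * T) * (1 + ‖ξ‖)) with hB
  have hB0 : ∀ T, 0 ≤ B T := fun T => by positivity
  have hstep : ∀ {s t T} k, s ≤ t → max t 0 ≤ T →
      ‖p k (M t k) - p k (M s k)‖ ≤ B T * (δ k * M t k - δ k * M s k) := fun k hst htT =>
    norm_eulerSeq_sub_le hK hg (hδ0 k).le ξ (hMmono k hst) ((hMle _ k).trans htT)
  have hlip : ∀ {s t T}, s ≤ t → max t 0 ≤ T → ‖x t - x s‖ ≤ B T * (max t 0 - max s 0) := by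
    intro s t T hst htT
    exact le_of_tendsto_of_tendsto ((hx t).sub (hx s)).norm
      (((hMlim t).sub (hMlim s)).const_mul _) (Eventually.of_forall fun k => hstep k hst htT)
  refine ⟨x, ?_, ?_, ?_⟩
  · intro t
    have key : ∀ a b, b ≤ t + 1 → a ≤ b → dist (x a) (x b) ≤ B (max (t + 1) 0) * dist a b := by
      intro a b hb hab
      have h1 : max b 0 ≤ max (t + 1) 0 := max_le_max_right 0 hb
      have h2 : max b 0 - max a 0 ≤ b - a := by
        rcases le_total a 0 with h | h
        · rw [max_eq_right h]
          rcases le_total b 0 with h' | h'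
          · rw [max_eq_right h']; linarith
          · rw [max_eq_left h']; linarith
        · rw [max_eq_left h, max_eq_left (h.trans hab)]
      rw [dist_comm, dist_eq_norm, dist_comm, Real.dist_eq, abs_of_nonneg (sub_nonneg.2 hab)]
      exact (hlip hab h1).trans (mul_le_mul_of_nonneg_left h2 (hB0 _))
    refine ⟨⟨B (max (t + 1) 0), hB0 _⟩, Iic (t + 1), Iic_mem_nhds (by linarith),
      LipschitzOnWith.of_dist_le_mul fun a ha b hb => ?_⟩
    rcases le_total a b with hab | hab
    · exact key a b hb hab
    · rw [dist_comm, dist_comm a]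
      exact key b a ha hab
  · refine tendsto_nhds_unique (hx 0) (tendsto_const_nhds.congr fun k => ?_)
    simp [hM, hp, eulerSeq]
  · intro t ht v hv s hsc hs hev
    obtain ⟨r, hr, hball⟩ := Metric.eventually_nhds_iff.1 hev
    have hslope := (hv.hasDerivWithinAt (s := Ioi t))
    rw [hasDerivWithinAt_iff_tendsto_slope' self_notMem_Ioi] at hslope
    refine hsc.mem_of_tendsto hslope ?_
    have hBpos : 0 < B (t + 1) + 1 := by linarith [hB0 (t + 1)]
    have hmem : Ioo t (t + min 1 (r / 2 / (B (t + 1) + 1))) ∈ 𝓝[>] t :=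
      Ioo_mem_nhdsGT (by have : 0 < min 1 (r / 2 / (B (t + 1) + 1)) := by positivity
                         linarith)
    filter_upwards [hmem] with q hq
    have hq1 : q ≤ t + 1 := hq.2.le.trans (by gcongr; exact min_le_left _ _)
    -- Half of `r` is for the drift of the scheme between `t` and `q`, the other half for its
    -- distance from `x t` at time `t`.
    have hqr : B (t + 1) * (q - t) < r / 2 := by
      have h1 : q - t < r / 2 / (B (t + 1) + 1) := by
        have := min_le_right 1 (r / 2 / (B (t + 1) + 1))
        linarith [hq.2]
      rw [lt_div_iff₀ hBpos] at h1
      nlinarith [hq.1]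
    have hq0 : 0 < q := ht.trans hq.1
    have hdiff : Tendsto (fun k => δ k * M q k - δ k * M t k) (hyperfilter ℕ) (𝓝 (q - t)) := by
      simpa [max_eq_left ht.le, max_eq_left hq0.le] using (hMlim q).sub (hMlim t)
    have hqt : 0 < q - t := sub_pos.2 hq.1
    refine hsc.mem_of_tendsto ((hdiff.inv₀ hqt.ne').smul ((hx q).sub (hx t))) ?_
    filter_upwards [hdiff.eventually (lt_mem_nhds hqt),
      (hdiff.const_mul (B (t + 1))).eventually (gt_mem_nhds hqr),
      (hx t).eventually (Metric.ball_mem_nhds _ (half_pos hr))] with k h1 h2 h3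
    have hcard : (M q k : ℝ) - M t k = ((M q k - M t k : ℕ) : ℝ) := by
      rw [Nat.cast_sub (hMmono k hq.1.le)]
    have hlt : M t k < M q k := by
      have : (M t k : ℝ) < M q k := by nlinarith [hδ0 k]
      exact_mod_cast this
    -- The difference quotient of the scheme is the average of `g` over nodes near `x t`; convexity
    -- of `s` keeps it in `s`, and closedness lets it pass to the limit.
    have hcm : (Finset.Ico (M t k) (M q k)).centerMass (fun _ => (1 : ℝ))
        (fun l => g (p k l)) ∈ s := by
      refine hs.centerMass_mem (fun _ _ => zero_le_one) (by simpa using hlt) fun l hl => ?_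
      obtain ⟨hl1, hl2⟩ := Finset.mem_Ico.1 hl
      refine hball ?_
      have hlq : δ k * l ≤ δ k * M q k := by
        have := hδ0 k
        gcongr
      have h4 : ‖p k l - p k (M t k)‖ ≤ B (t + 1) * (δ k * l - δ k * M t k) :=
        norm_eulerSeq_sub_le hK hg (hδ0 k).le ξ hl1
          (hlq.trans ((hMle q k).trans (max_le hq1 (by linarith))))
      have h5 : ‖p k l - p k (M t k)‖ < r / 2 := by
        refine h4.trans_lt (lt_of_le_of_lt ?_ h2)
        have := hB0 (t + 1)
        gcongr
      rw [← dist_eq_norm] at h5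
      have h6 : dist (p k (M t k)) (x t) < r / 2 := h3
      linarith [dist_triangle (p k l) (p k (M t k)) (x t)]
    convert! hcm using 1
    rw [Finset.centerMass]
    simp only [Finset.sum_const, Nat.card_Ico, nsmul_eq_mul, mul_one, one_smul]
    change (δ k * M q k - δ k * M t k)⁻¹ •
      (eulerSeq g (δ k) ξ (M q k) - eulerSeq g (δ k) ξ (M t k)) = _
    rw [eulerSeq_sub _ _ _ hlt.le, smul_smul, ← mul_sub, mul_inv, hcard, mul_comm, ← mul_assoc,
      mul_inv_cancel₀ (hδ0 k).ne', one_mul]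

end Euler

/-! ### Existence and extension of Filippov solutions. -/

theorem LocallyLipschitz.ae_differentiableAt_real {ι : Type*} [Fintype ι] {x : ℝ → ι → ℝ}
    (hx : LocallyLipschitz x) : ∀ᵐ t, DifferentiableAt ℝ x t := by
  have h : ∀ m : ℕ, ∀ᵐ t : ℝ, t ∈ uIcc (-m : ℝ) m → DifferentiableAt ℝ x t := fun m =>
    (hx.absolutelyContinuousOnInterval _ _).boundedVariationOn.ae_differentiableAt_of_mem_uIcc
  filter_upwards [ae_all_iff.2 h] with t ht
  obtain ⟨m, hm⟩ := exists_nat_ge |t|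
  refine ht m ?_
  rw [uIcc_of_le (by linarith [abs_nonneg t])]
  exact abs_le.1 hm

namespace BimodalSystem

variable {n : ℕ}

theorem mode_zero_mem_convexRhs {S : BimodalSystem n} {x : Fin n → ℝ} (h : S.output x ≤ 0) :
    S.mode 0 x ∈ S.convexRhs x := by
  unfold convexRhs
  rcases h.lt_or_eq with h | h
  · rw [if_pos h]; rfl
  · rw [if_neg h.not_lt, if_pos h]
    exact subset_convexHull ℝ _ (by simp)

theorem mode_one_mem_convexRhs {S : BimodalSystem n} {x : Fin n → ℝ} (h : 0 ≤ S.output x) :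
    S.mode 1 x ∈ S.convexRhs x := by
  unfold convexRhs
  rw [if_neg h.not_gt]
  split_ifs with h0
  · exact subset_convexHull ℝ _ (by simp)
  · rfl

theorem convex_convexRhs (S : BimodalSystem n) (x : Fin n → ℝ) : Convex ℝ (S.convexRhs x) := by
  unfold convexRhs
  split_ifs
  exacts [convex_singleton _, convex_convexHull _ _, convex_singleton _]

theorem isClosed_convexRhs (S : BimodalSystem n) (x : Fin n → ℝ) : IsClosed (S.convexRhs x) := by
  unfold convexRhs
  split_ifs
  exacts [isClosed_singleton, (Set.toFinite _).isClosed_convexHull ℝ, isClosed_singleton]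

open Classical in
/-- A single-valued selection of the right-hand side. -/
noncomputable def selection (S : BimodalSystem n) (y : Fin n → ℝ) : Fin n → ℝ :=
  if S.output y ≤ 0 then S.mode 0 y else S.mode 1 y

theorem exists_norm_selection_le (S : BimodalSystem n) :
    ∃ K ≥ 0, ∀ y, ‖S.selection y‖ ≤ K * (1 + ‖y‖) := by
  obtain ⟨K₀, hK₀, h₀⟩ := S.exists_mode_sub_le 0
  obtain ⟨K₁, hK₁, h₁⟩ := S.exists_mode_sub_le 1
  have aux : ∀ i K, (∀ x y, ‖S.mode i x - S.mode i y‖ ≤ K * ‖x - y‖) → ∀ y,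
      ‖S.mode i y‖ ≤ ‖S.mode i 0‖ + K * ‖y‖ := fun i K h y => by
    have := h y 0
    rw [sub_zero] at this
    linarith [norm_sub_norm_le (S.mode i y) (S.mode i 0)]
  refine ⟨K₀ + K₁ + ‖S.mode 0 0‖ + ‖S.mode 1 0‖, by positivity, fun y => ?_⟩
  have e0 := aux 0 K₀ h₀ y
  have e1 := aux 1 K₁ h₁ y
  have := norm_nonneg y
  have := norm_nonneg (S.mode 0 0)
  have := norm_nonneg (S.mode 1 0)
  unfold selection
  split_ifs <;> nlinarith [mul_nonneg hK₀ (norm_nonneg y), mul_nonneg hK₁ (norm_nonneg y)]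

/-- Upper semicontinuity of `convexRhs`: near `x` only modes admissible at `x` are selected. -/
theorem eventually_selection_mem (S : BimodalSystem n) (x : Fin n → ℝ) {η : ℝ} (hη : 0 < η) :
    ∀ᶠ y in 𝓝 x, S.selection y ∈ Metric.cthickening η (S.convexRhs x) := by
  have hclose : ∀ i, ∀ᶠ y in 𝓝 x, dist (S.mode i y) (S.mode i x) ≤ η := fun i =>
    ((S.continuous_mode i).tendsto x).eventually (Metric.closedBall_mem_nhds _ hη)
  have hout : ∀ᶠ y in 𝓝 x, (S.output y ≤ 0 → S.output x ≤ 0) ∧ (0 < S.output y → 0 ≤ S.output x) := by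
    rcases lt_trichotomy (S.output x) 0 with h | h | h
    · filter_upwards [(S.continuous_output.tendsto x).eventually (gt_mem_nhds h)] with y hy
      exact ⟨fun _ => h.le, fun h' => absurd h' hy.not_gt⟩
    · exact Eventually.of_forall fun y => ⟨fun _ => h.le, fun _ => h.ge⟩
    · filter_upwards [(S.continuous_output.tendsto x).eventually (lt_mem_nhds h)] with y hy
      exact ⟨fun h' => absurd h' hy.not_ge, fun _ => h.le⟩
  filter_upwards [hclose 0, hclose 1, hout] with y h0 h1 h2
  unfold selection
  split_ifs with h
  · exact Metric.mem_cthickening_of_dist_le _ _ _ _ (mode_zero_mem_convexRhs (h2.1 h)) h0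
  · exact Metric.mem_cthickening_of_dist_le _ _ _ _
      (mode_one_mem_convexRhs (h2.2 (not_le.1 h))) h1

/-- The Filippov inclusion holds for `x` at time `t`. -/
def FilippovAt (S : BimodalSystem n) (x : ℝ → Fin n → ℝ) (t : ℝ) : Prop :=
  ∃ v ∈ S.convexRhs (x t), HasDerivAt x v t

theorem FilippovAt.congr {S : BimodalSystem n} {x y : ℝ → Fin n → ℝ} {t : ℝ}
    (h : S.FilippovAt x t) (hxy : y =ᶠ[𝓝 t] x) : S.FilippovAt y t := by
  obtain ⟨v, hv, hd⟩ := h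
  exact ⟨v, by rwa [hxy.eq_of_nhds], hd.congr_of_eventuallyEq hxy⟩

theorem mem_convexRhs_of_forall_cthickening {S : BimodalSystem n} {x v : Fin n → ℝ}
    (h : ∀ η > 0, v ∈ Metric.cthickening η (S.convexRhs x)) : v ∈ S.convexRhs x := by
  rw [← (S.isClosed_convexRhs x).closure_eq, Metric.closure_eq_iInter_cthickening]
  simpa using h

theorem exists_forward_solution (S : BimodalSystem n) (ξ : Fin n → ℝ) :
    ∃ x : ℝ → Fin n → ℝ, LocallyLipschitz x ∧ x 0 = ξ ∧ ∀ᵐ t, 0 < t → S.FilippovAt x t := by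
  obtain ⟨K, hK, hg⟩ := S.exists_norm_selection_le
  obtain ⟨x, hxl, hx0, hx⟩ := exists_krasovskii_solution hK hg ξ
  refine ⟨x, hxl, hx0, ?_⟩
  filter_upwards [hxl.ae_differentiableAt_real] with t hd ht
  refine ⟨_, mem_convexRhs_of_forall_cthickening fun η hη => ?_, hd.hasDerivAt⟩
  exact hx t ht _ hd.hasDerivAt _ Metric.isClosed_cthickening ((S.convex_convexRhs _).cthickening _)
    (S.eventually_selection_mem _ hη)

/-- A forward solution for the negated selection, run backwards in time. -/
theorem exists_backward_solution (S : BimodalSystem n) (ξ : Fin n → ℝ) :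
    ∃ x : ℝ → Fin n → ℝ, LocallyLipschitz x ∧ x 0 = ξ ∧ ∀ᵐ t, t < 0 → S.FilippovAt x t := by
  obtain ⟨K, hK, hg⟩ := S.exists_norm_selection_le
  obtain ⟨y, hyl, hy0, hy⟩ := exists_krasovskii_solution (g := fun y => -S.selection y) hK
    (by simpa only [norm_neg] using hg) ξ
  have hxl : LocallyLipschitz fun t => y (-t) :=
    hyl.comp (LipschitzWith.id (α := ℝ)).neg.locallyLipschitz
  refine ⟨fun t => y (-t), hxl, by simpa using hy0, ?_⟩
  filter_upwards [hxl.ae_differentiableAt_real] with t hd ht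
  refine ⟨_, mem_convexRhs_of_forall_cthickening fun η hη => ?_, hd.hasDerivAt⟩
  have h1 : HasDerivAt y (-deriv (fun t => y (-t)) t) (-t) := by
    have h2 : HasDerivAt (fun t => y (-t)) (deriv (fun t => y (-t)) t) (- -t) := by
      rw [neg_neg]; exact hd.hasDerivAt
    simpa [Function.comp_def] using HasDerivAt.scomp (-t) h2 (hasDerivAt_neg (-t))
  have h3 := hy (-t) (neg_pos.2 ht) _ h1
    ((fun u => -u) ⁻¹' Metric.cthickening η (S.convexRhs (y (-t))))
    (Metric.isClosed_cthickening.preimage continuous_neg)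
    (((S.convex_convexRhs _).cthickening _).is_linear_preimage IsLinearMap.isLinearMap_neg)
    (by simpa using S.eventually_selection_mem _ hη)
  simpa using h3

theorem exists_glue {S : BimodalSystem n} {x y : ℝ → Fin n → ℝ} (hx : LocallyLipschitz x)
    (hy : LocallyLipschitz y) {a : ℝ} (hxy : x a = y a) :
    ∃ z : ℝ → Fin n → ℝ, LocallyLipschitz z ∧ (∀ t ≤ a, z t = x t) ∧ (∀ t ≥ a, z t = y t) ∧
      (∀ t < a, S.FilippovAt x t → S.FilippovAt z t) ∧
      ∀ t > a, S.FilippovAt y t → S.FilippovAt z t := by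
  -- This formula avoids a case split, so local Lipschitz continuity follows by composition.
  set z : ℝ → Fin n → ℝ := fun t => x (min t a) + y (max t a) - y a with hz
  have h1 : ∀ t ≤ a, z t = x t := fun t ht => by simp [hz, ht]
  have h2 : ∀ t ≥ a, z t = y t := fun t ht => by simp [hz, min_eq_right ht, max_eq_left ht, hxy]
  refine ⟨z, ?_, h1, h2, fun t ht h => h.congr ?_, fun t ht h => h.congr ?_⟩
  · exact ((hx.comp (LipschitzWith.id.min_const a).locallyLipschitz).add
      (hy.comp (LipschitzWith.id.max_const a).locallyLipschitz)).sub (LocallyLipschitz.const _)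
  · filter_upwards [Iio_mem_nhds ht] with s hs using h1 s (le_of_lt hs)
  · filter_upwards [Ioi_mem_nhds ht] with s hs using h2 s (le_of_lt hs)

theorem ae_ne_real (a : ℝ) : ∀ᵐ t : ℝ, t ≠ a := by simp [ae_iff, measure_singleton]

theorem exists_isFilippov (S : BimodalSystem n) (ξ : Fin n → ℝ) : ∃ x, S.IsFilippov ξ x := by
  obtain ⟨x, hxl, hx0, hx⟩ := S.exists_backward_solution ξ
  obtain ⟨y, hyl, hy0, hy⟩ := S.exists_forward_solution ξ
  obtain ⟨z, hzl, h1, h2, h3, h4⟩ := exists_glue (S := S) hxl hyl (a := 0) (hx0.trans hy0.symm)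
  refine ⟨z, hzl.absolutelyContinuousOnInterval, (h1 0 le_rfl).trans hx0, ?_⟩
  filter_upwards [hx, hy, ae_ne_real 0] with t hxt hyt ht
  rcases ht.lt_or_gt with ht | ht
  · exact h3 t ht (hxt ht)
  · exact h4 t ht (hyt ht)

/-- Right-uniqueness speaks of solutions on all of `ℝ`, so a local arc is glued to some solution
before `0` and some solution after `ε`. -/
theorem exists_isFilippov_of_local {S : BimodalSystem n} {φ : ℝ → Fin n → ℝ}
    (hφ : LocallyLipschitz φ) {ε : ℝ} (hε : 0 < ε) (h : ∀ t ∈ Ioo 0 ε, S.FilippovAt φ t) :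
    ∃ x, S.IsFilippov (φ 0) x ∧ ∀ t ∈ Icc 0 ε, x t = φ t := by
  obtain ⟨x, hx⟩ := S.exists_isFilippov (φ 0)
  obtain ⟨y, hyl, hy0, hy⟩ := S.exists_forward_solution (φ ε)
  have hyl' : LocallyLipschitz fun t => y (t - ε) :=
    hyl.comp (LipschitzWith.id.sub (LipschitzWith.const ε)).locallyLipschitz
  have hy' : ∀ᵐ t, ε < t → S.FilippovAt (fun t => y (t - ε)) t := by
    have := (measurePreserving_sub_right volume ε).quasiMeasurePreserving.ae hy
    filter_upwards [this] with t ht hlt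
    obtain ⟨v, hv, hd⟩ := ht (sub_pos.2 hlt)
    exact ⟨v, hv, HasDerivAt.comp_sub_const t ε hd⟩
  obtain ⟨z, hzl, h1, h2, h3, h4⟩ := exists_glue (S := S) hx.locallyLipschitz hφ (a := 0) hx.2.1
  obtain ⟨w, hwl, k1, k2, k3, k4⟩ := exists_glue (S := S) hzl hyl' (a := ε)
    (by simp [h2 ε hε.le, hy0])
  refine ⟨w, ⟨hwl.absolutelyContinuousOnInterval, ?_, ?_⟩, fun t ht => ?_⟩
  · rw [k1 0 hε.le, h2 0 le_rfl]
  · filter_upwards [hx.2.2, hy', ae_ne_real 0, ae_ne_real ε] with t hxt hyt ht0 htε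
    rcases htε.lt_or_gt with ht | ht
    · refine k3 t ht ?_
      rcases ht0.lt_or_gt with ht' | ht'
      · exact h3 t ht' hxt
      · exact h4 t ht' (h t ⟨ht', ht⟩)
    · exact k4 t ht (hyt ht)
  · rw [k1 t ht.2, h2 t ht.1]

end BimodalSystem

/-! ### Linear algebra and the observability index. -/

theorem LinearIndependent.exists_dotProduct_eq {m n : ℕ} {v : Fin m → Fin n → ℝ}
    (hv : LinearIndependent ℝ v) (b : Fin m → ℝ) : ∃ ξ, ∀ i, v i ⬝ᵥ ξ = b i := by
  have hrank : (Matrix.of v).rank = Fintype.card (Fin m) :=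
    LinearIndependent.rank_matrix (M := Matrix.of v) hv
  have htop : LinearMap.range (Matrix.of v).mulVecLin = ⊤ := by
    refine Submodule.eq_top_of_finrank_eq ?_
    rw [← Matrix.rank, hrank]
    simp
  obtain ⟨ξ, hξ⟩ := LinearMap.range_eq_top.1 htop b
  exact ⟨ξ, fun i => congrFun hξ i⟩

theorem exists_sum_range_of_mem_span {V : Type*} [AddCommGroup V] [Module ℝ V] {v : ℕ → V}
    {k : ℕ} {w : V} (h : w ∈ Submodule.span ℝ (range fun l : Fin k => v l)) :
    ∃ p : ℕ → ℝ, w = ∑ l ∈ Finset.range k, p l • v l := by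
  obtain ⟨p, hp⟩ := (Submodule.mem_span_range_iff_exists_fun ℝ).1 h
  refine ⟨fun l => if h : l < k then p ⟨l, h⟩ else 0, ?_⟩
  rw [← Fin.sum_univ_eq_sum_range (fun l => (if h : l < k then p ⟨l, h⟩ else 0) • v l), ← hp]
  simp

theorem sum_range_mem_span {V : Type*} [AddCommGroup V] [Module ℝ V] (v : ℕ → V) {k N : ℕ}
    (hkN : k ≤ N) (p : ℕ → ℝ) :
    ∑ l ∈ Finset.range k, p l • v l ∈ Submodule.span ℝ (range fun l : Fin N => v l) := by
  refine Submodule.sum_mem _ fun l hl => Submodule.smul_mem _ _ (Submodule.subset_span ?_)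
  exact ⟨⟨l, (Finset.mem_range.1 hl).trans_le hkN⟩, rfl⟩

namespace BimodalSystem

variable {n : ℕ}

theorem bddAbove_obsIndex (S : BimodalSystem n) (i : Fin 2) :
    BddAbove {k : ℕ | LinearIndependent ℝ (S.T i k).row} := by
  refine ⟨n, fun k hk => ?_⟩
  have := LinearIndependent.fintype_card_le_finrank (R := ℝ) hk
  simp only [Fintype.card_fin, Module.finrank_fintype_fun_eq_card] at this
  omega

theorem linearIndependent_obsRow {S : BimodalSystem n} (hc : S.c ≠ 0) (i : Fin 2) {k : ℕ}
    (hk : k ≤ S.obsIndex i) : LinearIndependent ℝ fun l : Fin (k + 1) => S.obsRow i l := by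
  have h0 : (0 : ℕ) ∈ {k : ℕ | LinearIndependent ℝ (S.T i k).row} := by
    change LinearIndependent ℝ fun l : Fin 1 => S.obsRow i l
    refine LinearIndependent.of_subsingleton (0 : Fin 1) ?_
    simpa [obsRow] using hc
  have hmem : LinearIndependent ℝ fun l : Fin (S.obsIndex i + 1) => S.obsRow i l :=
    Nat.sSup_mem ⟨0, h0⟩ (S.bddAbove_obsIndex i)
  exact hmem.comp (Fin.castLE (by omega)) (Fin.castLE_injective _)

/-- Otherwise one more row would be independent, against maximality of the index; for `c = 0` the
row is zero. -/
theorem obsRow_obsIndex_succ_mem (S : BimodalSystem n) (i : Fin 2) :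
    S.obsRow i (S.obsIndex i + 1) ∈
      Submodule.span ℝ (range fun l : Fin (S.obsIndex i + 1) => S.obsRow i l) := by
  by_cases hc : S.c = 0
  · rw [show S.obsRow i (S.obsIndex i + 1) = 0 by simp [obsRow, hc]]
    exact Submodule.zero_mem _
  by_contra hcon
  have h1 := (linearIndependent_obsRow hc i le_rfl).finSnoc hcon
  have h2 : S.obsIndex i + 1 ∈ {k : ℕ | LinearIndependent ℝ (S.T i k).row} := by
    change LinearIndependent ℝ fun l : Fin (S.obsIndex i + 1 + 1) => S.obsRow i l
    have e : (fun l : Fin (S.obsIndex i + 1 + 1) => S.obsRow i l) =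
        Fin.snoc (fun l : Fin (S.obsIndex i + 1) => S.obsRow i l)
          (S.obsRow i (S.obsIndex i + 1)) := by
      funext l
      refine Fin.lastCases ?_ (fun l => ?_) l <;> simp
    rw [e]
    exact h1
  exact absurd (le_csSup (S.bddAbove_obsIndex i) h2) (Nat.not_succ_le_self _)

/-! ### Flows of single modes and what right-uniqueness forces. -/

/-- The system both of whose modes are the mode `i` of `S`. -/
def single (S : BimodalSystem n) (i : Fin 2) : BimodalSystem n :=
  ⟨fun _ => S.A i, fun _ => S.e i, S.c, S.f⟩

theorem single_lie (S : BimodalSystem n) (i j : Fin 2) (l : ℕ) (ξ : Fin n → ℝ) :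
    (S.single i).lie j l ξ = S.lie i l ξ := by
  cases l <;> rfl

/-- Lets the sign analysis of regular systems serve for the flow of one mode: the triangular
relation is the identity. -/
theorem single_isRegular (S : BimodalSystem n) (i : Fin 2) :
    (S.single i).IsRegular (S.obsIndex i + 1) where
  lieTriangular := ⟨fun _ => 1, fun _ _ => 0, fun j _ => ⟨one_pos, fun ξ => by
    simp [single_lie]⟩⟩
  obsRow_mem := exists_sum_range_of_mem_span (S.obsRow_obsIndex_succ_mem i)
  mode_eq _ _ := rfl

theorem exists_modeFlow (S : BimodalSystem n) (i : Fin 2) (ξ : Fin n → ℝ) :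
    ∃ φ, (S.single i).IsFilippov ξ φ ∧ ∀ t, HasDerivAt φ (S.mode i (φ t)) t := by
  obtain ⟨φ, hφ⟩ := (S.single i).exists_isFilippov ξ
  refine ⟨φ, hφ, fun t => ?_⟩
  refine hφ.locallyLipschitz.hasDerivAt_of_ae (a := t - 1) (b := t + 1)
    ((S.continuous_mode i).comp hφ.1.continuous) ?_ t ⟨by linarith, by linarith⟩
  filter_upwards [hφ.2.2] with s hs _
  obtain ⟨v, hv, hd⟩ := hs
  rw [convexRhs_of_mode_eq rfl 0, mem_singleton_iff] at hv
  rwa [hv] at hd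

/-- The Lie derivatives along mode `i` at `ξ` vanish, or the first nonzero one has the sign of
`σ`. -/
def LieSign (S : BimodalSystem n) (i : Fin 2) (σ : ℝ) (ξ : Fin n → ℝ) : Prop :=
  (∀ l ≤ S.obsIndex i + 1, S.lie i l ξ = 0) ∨
    ∃ j ≤ S.obsIndex i + 1, (∀ l < j, S.lie i l ξ = 0) ∧ 0 < σ * S.lie i j ξ

theorem lieSign_of_forall_le {S : BimodalSystem n} {i : Fin 2} {σ : ℝ} {ξ : Fin n → ℝ} {k : ℕ}
    (hk : k ≤ S.obsIndex i) (h0 : ∀ l ≤ k, S.lie i l ξ = 0) (h : 0 < σ * S.lie i (k + 1) ξ) :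
    S.LieSign i σ ξ :=
  Or.inr ⟨k + 1, by omega, fun l hl => h0 l (by omega), h⟩

/-- The second conclusion records that the flow can meet the switching hyperplane at these times
only in the degenerate case. -/
theorem modeFlow_sign {S : BimodalSystem n} {i : Fin 2} {σ : ℝ} (hσ : σ = 1 ∨ σ = -1)
    {ξ : Fin n → ℝ} (hs : S.LieSign i σ ξ) {φ : ℝ → Fin n → ℝ}
    (hφ : (S.single i).IsFilippov ξ φ) :
    ∃ ε > 0, ∀ t ∈ Ioo 0 ε, 0 ≤ σ * S.output (φ t) ∧
      (σ * S.output (φ t) = 0 → ∀ l ≤ S.obsIndex i + 1, S.lie i l ξ = 0) := by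
  have hreg := S.single_isRegular i
  have hξ := hφ.2.1
  rcases hs with h0 | ⟨j, hj, h0, hpos⟩
  · refine ⟨1, one_pos, fun t _ => ?_⟩
    have := hreg.lie_eq_zero hφ (t₀ := 0) (by simpa only [single_lie, hξ] using h0) t 0
      (Nat.zero_le _)
    rw [single_lie, lie_zero] at this
    rw [this, mul_zero]
    exact ⟨le_rfl, fun _ => h0⟩
  · have hev : ∀ᶠ t in 𝓝[>] 0, 0 < σ * S.output (φ t) := by
      have h0' : ∀ l < j, (S.single i).lie 1 l (φ 0) = 0 := by simpa only [single_lie, hξ] using h0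
      rcases hσ with rfl | rfl
      · simpa using! hreg.eventually_output_pos hφ hj h0'
          (by simpa only [single_lie, hξ, one_mul] using hpos)
      · simpa using! hreg.eventually_output_neg hφ hj h0'
          (by simpa only [single_lie, hξ, neg_one_mul, neg_pos] using hpos)
    obtain ⟨ε, hε, h⟩ := exists_forall_Ioo_right hev
    rw [zero_add] at h
    exact ⟨ε, hε, fun t ht => ⟨(h t ht).le, fun h0 => absurd h0 (h t ht).ne'⟩⟩

/-- If both modes can be followed from `ξ`, then right-uniqueness forces them to coincide. -/
theorem RightUniqueness.eq_of_lieSign {S : BimodalSystem n} (hS : S.RightUniqueness)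
    {ξ : Fin n → ℝ} (h0 : S.LieSign 0 (-1) ξ) (h1 : S.LieSign 1 1 ξ) :
    (∀ l ≤ S.obsIndex 0 + 1, S.lie 0 l ξ = 0) ∧ (∀ l ≤ S.obsIndex 1 + 1, S.lie 1 l ξ = 0) ∧
      S.mode 0 ξ = S.mode 1 ξ := by
  obtain ⟨φ, hφ, hφd⟩ := S.exists_modeFlow 0 ξ
  obtain ⟨ψ, hψ, hψd⟩ := S.exists_modeFlow 1 ξ
  obtain ⟨ε, hε, hsφ⟩ := modeFlow_sign (Or.inr rfl) h0 hφ
  obtain ⟨δ, hδ, hsψ⟩ := modeFlow_sign (Or.inl rfl) h1 hψ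
  obtain ⟨x, hx, hxφ⟩ := exists_isFilippov_of_local hφ.locallyLipschitz hε (S := S)
    (fun t ht => ⟨_, mode_zero_mem_convexRhs (by linarith [(hsφ t ht).1]), hφd t⟩)
  obtain ⟨y, hy, hyψ⟩ := exists_isFilippov_of_local hψ.locallyLipschitz hδ (S := S)
    (fun t ht => ⟨_, mode_one_mem_convexRhs (by linarith [(hsψ t ht).1]), hψd t⟩)
  rw [hφ.2.1] at hx
  rw [hψ.2.1] at hy
  obtain ⟨r, hr, hxy⟩ := hS ξ x hx y hy
  set s := min r (min ε δ) with hs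
  have hs0 : 0 < s := lt_min hr (lt_min hε hδ)
  have hsr : s ≤ r := min_le_left _ _
  have hsε : s ≤ ε := (min_le_right _ _).trans (min_le_left _ _)
  have hsδ : s ≤ δ := (min_le_right _ _).trans (min_le_right _ _)
  have heq : ∀ t ∈ Ico 0 s, φ t = ψ t := fun t ht => by
    rw [← hxφ t ⟨ht.1, ht.2.le.trans hsε⟩, ← hyψ t ⟨ht.1, ht.2.le.trans hsδ⟩]
    exact hxy t ⟨ht.1, ht.2.trans_le hsr⟩
  have hm : s / 2 ∈ Ioo 0 s := ⟨half_pos hs0, half_lt_self hs0⟩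
  have e := heq (s / 2) ⟨hm.1.le, hm.2⟩
  have a0 := hsφ (s / 2) ⟨hm.1, hm.2.trans_le hsε⟩
  have a1 := hsψ (s / 2) ⟨hm.1, hm.2.trans_le hsδ⟩
  rw [e] at a0
  -- The common arc lies in both closed half-spaces, hence on the hyperplane.
  have hzero : S.output (ψ (s / 2)) = 0 := by linarith [a0.1, a1.1]
  refine ⟨a0.2 (by rw [hzero, mul_zero]), a1.2 (by rw [hzero, mul_zero]), ?_⟩
  -- The flows are known to agree only to the right of `0`, so one-sided derivatives are compared.
  have d0 := (hφd 0).hasDerivWithinAt (s := Ici 0)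
  have d1 := (hψd 0).hasDerivWithinAt (s := Ici 0)
  have hev : φ =ᶠ[𝓝[≥] 0] ψ := by
    filter_upwards [Ico_mem_nhdsGE hs0] with t ht using heq t ht
  have d2 := d1.congr_of_eventuallyEq hev (heq 0 ⟨le_rfl, hs0⟩)
  have := (uniqueDiffOn_Ici (0 : ℝ) 0 self_mem_Ici).eq_deriv _ d0 d2
  rwa [hφ.2.1, hψ.2.1] at this

/-! ### Building the triangular relation order by order. -/

/-- The `j`-th Lie derivative along the first mode is a positive multiple of the one along the
second mode plus a combination of lower Lie derivatives plus the constant `γ`. -/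
def LieRel (S : BimodalSystem n) (j : ℕ) (γ : ℝ) : Prop :=
  ∃ μ > 0, ∃ m : ℕ → ℝ,
    S.obsRow 0 j = μ • S.obsRow 1 j + ∑ l ∈ Finset.range j, m l • S.obsRow 1 l ∧
    S.obsOffset 0 j = μ * S.obsOffset 1 j + ∑ l ∈ Finset.range j, m l * S.obsOffset 1 l + γ

theorem lieTriangular_of_lieRel {S : BimodalSystem n} {N : ℕ} (h : ∀ j ≤ N, S.LieRel j 0) :
    S.LieTriangular N := by
  choose! μ hμ m hr ho using h
  refine ⟨μ, m, fun j hj => ⟨hμ j hj, fun ξ => ?_⟩⟩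
  simp only [lie, hr j hj, ho j hj, add_dotProduct, sum_dotProduct, smul_dotProduct, smul_eq_mul,
    mul_add, Finset.sum_add_distrib]
  ring

theorem exists_isLowerPos_of_lieRel {S : BimodalSystem n} {N : ℕ} {γ : ℕ → ℝ}
    (h : ∀ j ≤ N, S.LieRel j (γ j)) :
    ∃ M : Matrix (Fin (N + 1)) (Fin (N + 1)) ℝ, IsLowerPos M ∧ S.T 0 N = M * S.T 1 N ∧
      ∀ j : Fin (N + 1), (S.E 0 N - M *ᵥ S.E 1 N) j = γ j := by
  choose! μ hμ m hr ho using h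
  set b : ℕ → ℕ → ℝ := fun j l => if l < j then m j l else if l = j then μ j else 0 with hb
  -- Stated for a general module, as it serves both the rows and the scalar offsets.
  have hsum : ∀ {V : Type} [AddCommGroup V] [Module ℝ V] (w : ℕ → V) (j : ℕ), j ≤ N →
      ∑ l : Fin (N + 1), b j l • w l = μ j • w j + ∑ l ∈ Finset.range j, m j l • w l := by
    intro V _ _ w j hj
    rw [Fin.sum_univ_eq_sum_range (fun l => b j l • w l) (N + 1),
      ← Finset.sum_subset (Finset.range_mono (show j + 1 ≤ N + 1 by omega)) (fun l hl hl' => by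
        have : j < l := by simpa using hl'
        simp [hb, this.not_gt, this.ne']), Finset.sum_range_succ, add_comm]
    congr 1
    · simp [hb]
    · exact Finset.sum_congr rfl fun l hl => by simp [hb, Finset.mem_range.1 hl]
  refine ⟨Matrix.of fun j l => b j l, ⟨fun i j hij => ?_, fun i => ?_⟩, ?_, fun j => ?_⟩
  · have hij' : (i : ℕ) < j := hij
    simp only [hb, Matrix.of_apply, if_neg hij'.not_gt, if_neg hij'.ne']
  · simpa [hb] using hμ i (by omega)
  · ext j k
    have h1 := congrFun (hr j (by omega)) k
    rw [← hsum (S.obsRow 1) j (by omega)] at h1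
    simpa [Matrix.mul_apply, T] using! h1
  · have h1 := ho j (by omega)
    have h2 := hsum (S.obsOffset 1) j (by omega)
    simp only [smul_eq_mul] at h2
    rw [Pi.sub_apply, E_apply, h1, ← h2]
    simp [mulVec, dotProduct, E_apply]

theorem lexCondition_of_lieRel {S : BimodalSystem n} {k : ℕ} {γ : ℝ} (hk : k ≤ S.minIndex)
    (h : ∀ j ≤ k, S.LieRel j 0) (hγ : S.LieRel (k + 1) γ) (hpos : 0 < γ) : S.LexCondition := by
  obtain ⟨M, hM, hT, hE⟩ := exists_isLowerPos_of_lieRel (S := S) (N := k + 1)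
    (γ := fun j => if j = k + 1 then γ else 0) (fun j hj => by
      split_ifs with hj'
      · rwa [hj']
      · exact h j (by omega))
  refine ⟨k + 1, by omega, by omega, M, hM, hT, Fin.last _, ?_, fun j hj => ?_⟩
  · rw [hE]; simpa using hpos
  · have : (j : ℕ) ≠ k + 1 := (Fin.lt_def.1 hj).ne
    rw [hE, if_neg this]

theorem exists_lie_eq {S : BimodalSystem n} (hc : S.c ≠ 0) (i : Fin 2) {k : ℕ}
    (hk : k ≤ S.obsIndex i) (w : ℕ → ℝ) : ∃ ξ, ∀ l ≤ k, S.lie i l ξ = w l := by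
  obtain ⟨ξ, hξ⟩ := (linearIndependent_obsRow hc i hk).exists_dotProduct_eq
    (fun l => w l - S.obsOffset i l)
  refine ⟨ξ, fun l hl => ?_⟩
  have := hξ ⟨l, by omega⟩
  simp only at this
  rw [lie, this, sub_add_cancel]

theorem lieRel_zero (S : BimodalSystem n) : S.LieRel 0 0 :=
  ⟨1, one_pos, 0, by simp [obsRow], by simp [obsOffset]⟩

/-- Where the orders up to `k` vanish, uniqueness forbids `lie 1 (k + 1) > 0` together with `lie 0
(k + 1) < 0`. If the rows of order `k + 1` were not tied together, both values could be prescribed;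
so on that set `lie 0 (k + 1)` is an affine function of `lie 1 (k + 1)` that is nonnegative for
positive arguments. -/
theorem RightUniqueness.exists_lieRel_succ {S : BimodalSystem n} (hS : S.RightUniqueness)
    (hc : S.c ≠ 0) {k : ℕ} (hk : k < S.minIndex) (h : ∀ j ≤ k, S.LieRel j 0) :
    ∃ γ ≥ 0, S.LieRel (k + 1) γ := by
  have hk0 : k + 1 ≤ S.obsIndex 0 := hk.trans_le (min_le_left _ _)
  have hk1 : k + 1 ≤ S.obsIndex 1 := hk.trans_le (min_le_right _ _)
  have htri := lieTriangular_of_lieRel h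
  have hcontra : ∀ ξ, (∀ l ≤ k, S.lie 1 l ξ = 0) → 0 < S.lie 1 (k + 1) ξ →
      0 ≤ S.lie 0 (k + 1) ξ := by
    intro ξ hξ hpos
    by_contra! hneg
    have := (hS.eq_of_lieSign
      (lieSign_of_forall_le (by omega) (htri.lie_zero_eq_zero hξ) (by linarith))
      (lieSign_of_forall_le (by omega) hξ (by linarith))).2.1 (k + 1) (by omega)
    exact hpos.ne' this
  have hmem : S.obsRow 0 (k + 1) ∈
      Submodule.span ℝ (range fun l : Fin (k + 1 + 1) => S.obsRow 1 l) := by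
    by_contra hcon
    obtain ⟨ξ, hξ⟩ := ((linearIndependent_obsRow hc 1 hk1).finSnoc hcon).exists_dotProduct_eq
      (Fin.snoc (fun l => (if (l : ℕ) = k + 1 then 1 else 0) - S.obsOffset 1 l)
        (-1 - S.obsOffset 0 (k + 1)))
    have e1 : ∀ l ≤ k + 1, S.lie 1 l ξ = if l = k + 1 then 1 else 0 := fun l hl => by
      have := hξ (Fin.castSucc ⟨l, by omega⟩)
      simp only [Fin.snoc_castSucc] at this
      rw [lie, this, sub_add_cancel]
    have e0 : S.lie 0 (k + 1) ξ = -1 := by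
      have := hξ (Fin.last _)
      simp only [Fin.snoc_last] at this
      rw [lie, this, sub_add_cancel]
    have := hcontra ξ (fun l hl => by rw [e1 l (by omega), if_neg (by omega)])
      (by rw [e1 _ le_rfl, if_pos rfl]; exact one_pos)
    linarith
  obtain ⟨p, hp⟩ := exists_sum_range_of_mem_span hmem
  set γ := S.obsOffset 0 (k + 1) - ∑ l ∈ Finset.range (k + 1 + 1), p l * S.obsOffset 1 l with hγ
  have hlie : ∀ ξ, (∀ l ≤ k, S.lie 1 l ξ = 0) →
      S.lie 0 (k + 1) ξ = p (k + 1) * S.lie 1 (k + 1) ξ + γ := by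
    intro ξ hξ
    have e : S.lie 0 (k + 1) ξ = ∑ l ∈ Finset.range (k + 1 + 1), p l * S.lie 1 l ξ + γ := by
      simp only [lie, hp, sum_dotProduct, smul_dotProduct, smul_eq_mul, mul_add,
        Finset.sum_add_distrib, hγ]
      ring
    rw [e, Finset.sum_range_succ, Finset.sum_eq_zero fun l hl => by
      rw [hξ l (by have := Finset.mem_range.1 hl; omega), mul_zero], zero_add]
  have hnonneg : ∀ t > 0, 0 ≤ p (k + 1) * t + γ := by
    intro t ht
    obtain ⟨ξ, hξ⟩ := exists_lie_eq hc 1 hk1 (fun l => if l = k + 1 then t else 0)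
    have e0 : ∀ l ≤ k, S.lie 1 l ξ = 0 := fun l hl => by
      rw [hξ l (by omega), if_neg (by omega)]
    have e1 : S.lie 1 (k + 1) ξ = t := by rw [hξ _ le_rfl, if_pos rfl]
    have := hcontra ξ e0 (by rwa [e1])
    rwa [hlie ξ e0, e1] at this
  -- A negative slope is refuted by a large `t`, and below a negative `γ` by a small one.
  have hp0 : 0 ≤ p (k + 1) := by
    by_contra! hneg
    have := hnonneg ((|γ| + 1) / -p (k + 1)) (by have := neg_pos.2 hneg; positivity)
    rw [show p (k + 1) * ((|γ| + 1) / -p (k + 1)) = -(|γ| + 1) by field_simp [hneg.ne]] at this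
    linarith [le_abs_self γ]
  have hγ0 : 0 ≤ γ := by
    by_contra! hneg
    have := hnonneg (-γ / (2 * (p (k + 1) + 1))) (by have := neg_pos.2 hneg; positivity)
    have h2 : p (k + 1) * (-γ / (2 * (p (k + 1) + 1))) ≤ -γ / 2 := by
      rw [mul_div_assoc', div_le_div_iff₀ (by positivity) two_pos]
      nlinarith
    linarith
  -- Slope zero would make `lie 0 (k + 1)` constantly `γ`, yet independence of the rows of mode `0`
  -- permits the value `γ + 1`.
  have hpne : p (k + 1) ≠ 0 := by
    intro hp1
    obtain ⟨ξ, hξ⟩ := exists_lie_eq hc 0 hk0 (fun l => if l = k + 1 then γ + 1 else 0)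
    have e0 : ∀ l ≤ k, S.lie 0 l ξ = 0 := fun l hl => by
      rw [hξ l (by omega), if_neg (by omega)]
    have := hlie ξ (htri.lie_one_eq_zero e0)
    rw [hξ _ le_rfl, if_pos rfl, hp1] at this
    linarith
  refine ⟨γ, hγ0, p (k + 1), lt_of_le_of_ne hp0 hpne.symm, p, ?_, ?_⟩
  · rw [hp, Finset.sum_range_succ, add_comm]
  · rw [hγ, Finset.sum_range_succ _ (k + 1)]; ring

theorem RightUniqueness.lexCondition_or_lieRel {S : BimodalSystem n} (hS : S.RightUniqueness)
    (hc : S.c ≠ 0) (k : ℕ) (hk : k ≤ S.minIndex) : S.LexCondition ∨ ∀ j ≤ k, S.LieRel j 0 := by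
  induction k with
  | zero =>
    right
    intro j hj
    obtain rfl : j = 0 := by omega
    exact S.lieRel_zero
  | succ k ih =>
    rcases ih (by omega) with h | h
    · exact Or.inl h
    obtain ⟨γ, hγ, hrel⟩ := hS.exists_lieRel_succ hc hk h
    rcases hγ.lt_or_eq with hpos | rfl
    · exact Or.inl (lexCondition_of_lieRel (by omega) h hrel hpos)
    · right
      intro j hj
      rcases hj.lt_or_eq with hj | rfl
      · exact h j (by omega)
      · exact hrel

/-- At a point where the lower Lie derivatives vanish, the next one equals the number in
`SignCondition`. -/
theorem signCondition_of_lie {S : BimodalSystem n} {i : Fin 2} {σ : ℝ} {ξ : Fin n → ℝ}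
    (h0 : ∀ l ≤ S.obsIndex i, S.lie i l ξ = 0) (h : 0 < σ * S.lie i (S.obsIndex i + 1) ξ) :
    S.SignCondition i σ := by
  obtain ⟨p, hp⟩ := exists_sum_range_of_mem_span (S.obsRow_obsIndex_succ_mem i)
  refine ⟨fun l => p l, ?_, ?_⟩
  · change S.obsRow i (S.obsIndex i + 1) = _
    rw [hp, ← Fin.sum_univ_eq_sum_range (fun l => p l • S.obsRow i l)]
    ext k
    simp [vecMul, dotProduct, T, obsRow]
  · convert h using 2
    have e1 : (fun l : Fin (S.obsIndex i + 1) => p l) ⬝ᵥ S.E i (S.obsIndex i) =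
        ∑ l ∈ Finset.range (S.obsIndex i + 1), p l * S.obsOffset i l := by
      rw [← Fin.sum_univ_eq_sum_range (fun l => p l * S.obsOffset i l)]
      simp [dotProduct, E_apply]
    have e2 : S.obsRow i (S.obsIndex i + 1) ⬝ᵥ ξ =
        -∑ l ∈ Finset.range (S.obsIndex i + 1), p l * S.obsOffset i l := by
      rw [hp, sum_dotProduct, ← Finset.sum_neg_distrib]
      refine Finset.sum_congr rfl fun l hl => ?_
      have := h0 l (by have := Finset.mem_range.1 hl; omega)
      unfold lie at this
      rw [smul_dotProduct, smul_eq_mul, eq_neg_of_add_eq_zero_left this, mul_neg]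
    rw [e1, lie, e2, obsOffset]
    ring

theorem equalIndexCondition_of_lieRel {S : BimodalSystem n} (hi : S.obsIndex 0 = S.obsIndex 1)
    (h : ∀ j ≤ S.minIndex + 1, S.LieRel j 0) : S.EqualIndexCondition := by
  obtain ⟨M, hM, hT, hE⟩ := exists_isLowerPos_of_lieRel (γ := fun _ => 0) h
  exact ⟨hi, M, hM, hT, sub_eq_zero.1 (funext hE)⟩

theorem equalIndexCondition_of_c_eq_zero {S : BimodalSystem n} (hc : S.c = 0) :
    S.EqualIndexCondition := by
  have hT : ∀ k, S.T 0 k = S.T 1 k := fun k => by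
    ext j l
    simp [T, hc]
  refine equalIndexCondition_of_lieRel ?_ fun j _ => ⟨1, one_pos, 0, ?_, ?_⟩
  · simp only [obsIndex, hT]
  · simp [obsRow, hc]
  · cases j <;> simp [obsOffset, hc]

/-- If the observability indices agree, the next order relation holds with any positive
diagonal entry. -/
theorem lieRel_succ_of_index_eq {S : BimodalSystem n} {h : ℕ} (h0 : S.obsIndex 0 = h)
    (h1 : S.obsIndex 1 = h) (hrel : ∀ j ≤ h, S.LieRel j 0) {ξ : Fin n → ℝ}
    (hξ : ∀ l ≤ h, S.lie 1 l ξ = 0) {μ : ℝ} (hμ : 0 < μ) :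
    S.LieRel (h + 1) (S.lie 0 (h + 1) ξ - μ * S.lie 1 (h + 1) ξ) := by
  have hm1 := S.obsRow_obsIndex_succ_mem 1
  have hm0 := S.obsRow_obsIndex_succ_mem 0
  rw [h1] at hm1
  rw [h0] at hm0
  -- The rows of order `h + 1` of both modes lie in the span of the lower rows of mode `1`, so the
  -- coefficient `μ` is free; evaluation at `ξ` identifies the constant.
  have hle : Submodule.span ℝ (range fun l : Fin (h + 1) => S.obsRow 0 l) ≤
      Submodule.span ℝ (range fun l : Fin (h + 1) => S.obsRow 1 l) := by
    rw [Submodule.span_le]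
    rintro _ ⟨l, rfl⟩
    obtain ⟨μ, -, m, hr, -⟩ := hrel l (by omega)
    simp only [SetLike.mem_coe]
    rw [hr]
    exact Submodule.add_mem _ (Submodule.smul_mem _ _ (Submodule.subset_span ⟨l, rfl⟩))
      (sum_range_mem_span _ (by omega) m)
  obtain ⟨m, hm⟩ := exists_sum_range_of_mem_span
    (Submodule.sub_mem _ (hle hm0) (Submodule.smul_mem _ μ hm1))
  rw [sub_eq_iff_eq_add'] at hm
  refine ⟨μ, hμ, m, hm, ?_⟩
  have e : ∑ l ∈ Finset.range (h + 1), m l * (S.obsRow 1 l ⬝ᵥ ξ) =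
      -∑ l ∈ Finset.range (h + 1), m l * S.obsOffset 1 l := by
    rw [← Finset.sum_neg_distrib]
    refine Finset.sum_congr rfl fun l hl => ?_
    have := hξ l (by have := Finset.mem_range.1 hl; omega)
    unfold lie at this
    rw [eq_neg_of_add_eq_zero_left this, mul_neg]
  simp only [lie, hm, add_dotProduct, sum_dotProduct, smul_dotProduct, smul_eq_mul, e]
  ring

theorem RightUniqueness.conditions {S : BimodalSystem n} (hS : S.RightUniqueness) :
    S.LexCondition ∨ S.UnequalIndexCondition ∨ S.EqualIndexCondition := by
  by_cases hc : S.c = 0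
  · exact Or.inr (Or.inr (equalIndexCondition_of_c_eq_zero hc))
  rcases hS.lexCondition_or_lieRel hc S.minIndex le_rfl with hlex | hrel
  · exact Or.inl hlex
  have htri := lieTriangular_of_lieRel hrel
  have hM : ∃ M : Matrix (Fin (S.minIndex + 1)) (Fin (S.minIndex + 1)) ℝ,
      IsLowerPos M ∧ S.T 0 S.minIndex = M * S.T 1 S.minIndex ∧
        S.E 0 S.minIndex = M *ᵥ S.E 1 S.minIndex := by
    obtain ⟨M, hM, hT, hE⟩ := exists_isLowerPos_of_lieRel (γ := fun _ => 0) hrel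
    exact ⟨M, hM, hT, sub_eq_zero.1 (funext hE)⟩
  rcases lt_trichotomy (S.obsIndex 0) (S.obsIndex 1) with hlt | heq | hgt
  · have hmin : S.minIndex = S.obsIndex 0 := min_eq_left hlt.le
    rw [hmin] at htri
    -- Mode `1` can be followed from this `ξ`. If the sign condition failed, so could mode `0`, and
    -- then `lie 1` of this order would vanish instead of being `1`.
    obtain ⟨ξ, hξ⟩ := exists_lie_eq hc 1 (k := S.obsIndex 0 + 1) hlt
      (fun l => if l = S.obsIndex 0 + 1 then 1 else 0)
    have e1 : ∀ l ≤ S.obsIndex 0, S.lie 1 l ξ = 0 := fun l hl => by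
      rw [hξ l (by omega), if_neg (by omega)]
    have e2 : S.lie 1 (S.obsIndex 0 + 1) ξ = 1 := by rw [hξ _ le_rfl, if_pos rfl]
    have e0 := htri.lie_zero_eq_zero e1
    refine Or.inr (Or.inl ⟨hM, Or.inl ⟨hlt, signCondition_of_lie e0 ?_⟩⟩)
    rw [one_mul]
    by_contra! hle
    have hsign : S.LieSign 0 (-1) ξ := by
      rcases hle.lt_or_eq with hneg | hzero
      · exact lieSign_of_forall_le le_rfl e0 (by linarith)
      · refine Or.inl fun l hl => ?_
        rcases hl.lt_or_eq with hl | rfl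
        exacts [e0 l (by omega), hzero]
    have := (hS.eq_of_lieSign hsign (lieSign_of_forall_le hlt.le e1 (by rw [e2]; norm_num))).2.1
      (S.obsIndex 0 + 1) (by omega)
    linarith
  · have hmin : S.minIndex = S.obsIndex 0 := min_eq_left heq.le
    have hrel' := hrel
    rw [hmin] at htri hrel'
    obtain ⟨ξ, hξ⟩ := exists_lie_eq hc 1 (k := S.obsIndex 0) heq.le (fun _ => 0)
    have e0 := htri.lie_zero_eq_zero hξ
    have hsucc := fun μ (hμ : 0 < μ) => lieRel_succ_of_index_eq rfl heq.symm hrel' hξ (μ := μ) hμ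
    set γ₀ := S.lie 0 (S.obsIndex 0 + 1) ξ with hγ₀
    set γ₁ := S.lie 1 (S.obsIndex 0 + 1) ξ with hγ₁
    -- The free diagonal entry is used here: if no `μ` gives a positive constant, large `μ` forces
    -- `0 ≤ γ₁` and small `μ` forces `γ₀ ≤ 0`. Both modes can then be followed from `ξ`, so both
    -- numbers vanish.
    by_cases hpos : ∃ μ > 0, 0 < γ₀ - μ * γ₁
    · obtain ⟨μ, hμ, hpos⟩ := hpos
      exact Or.inl (lexCondition_of_lieRel hmin.ge hrel' (hsucc μ hμ) hpos)
    push Not at hpos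
    have hγ₁0 : 0 ≤ γ₁ := by
      by_contra! hneg
      have := hpos ((|γ₀| + 1) / -γ₁) (by have := neg_pos.2 hneg; positivity)
      rw [show (|γ₀| + 1) / -γ₁ * γ₁ = -(|γ₀| + 1) by field_simp [hneg.ne]] at this
      linarith [neg_abs_le γ₀]
    have hγ₀0 : γ₀ ≤ 0 := by
      by_contra! hp
      have := hpos (γ₀ / (2 * (γ₁ + 1))) (by positivity)
      have h2 : γ₀ / (2 * (γ₁ + 1)) * γ₁ ≤ γ₀ / 2 := by
        rw [div_mul_eq_mul_div, div_le_div_iff₀ (by positivity) two_pos]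
        nlinarith
      linarith
    have hs0 : S.LieSign 0 (-1) ξ := by
      rcases hγ₀0.lt_or_eq with hneg | hzero
      · exact lieSign_of_forall_le le_rfl e0 (by linarith)
      · refine Or.inl fun l hl => ?_
        rcases hl.lt_or_eq with hl | rfl
        exacts [e0 l (by omega), hzero]
    have hs1 : S.LieSign 1 1 ξ := by
      rcases hγ₁0.lt_or_eq with hp | hzero
      · exact lieSign_of_forall_le heq.le hξ (by linarith)
      · refine Or.inl fun l hl => ?_
        rw [← heq] at hl
        rcases hl.lt_or_eq with hl | rfl
        exacts [hξ l (by omega), hzero.symm]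
    obtain ⟨z0, z1, -⟩ := hS.eq_of_lieSign hs0 hs1
    have hlast := hsucc 1 one_pos
    rw [hγ₀, hγ₁, z0 _ le_rfl, z1 _ (by omega), mul_zero, sub_zero] at hlast
    refine Or.inr (Or.inr (equalIndexCondition_of_lieRel heq fun j hj => ?_))
    rw [hmin] at hj
    rcases hj.lt_or_eq with hj | rfl
    exacts [hrel' j (by omega), hlast]
  · have hmin : S.minIndex = S.obsIndex 1 := min_eq_right hgt.le
    rw [hmin] at htri
    obtain ⟨ξ, hξ⟩ := exists_lie_eq hc 0 (k := S.obsIndex 1 + 1) hgt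
      (fun l => if l = S.obsIndex 1 + 1 then -1 else 0)
    have e0 : ∀ l ≤ S.obsIndex 1, S.lie 0 l ξ = 0 := fun l hl => by
      rw [hξ l (by omega), if_neg (by omega)]
    have e2 : S.lie 0 (S.obsIndex 1 + 1) ξ = -1 := by rw [hξ _ le_rfl, if_pos rfl]
    have e1 := htri.lie_one_eq_zero e0
    refine Or.inr (Or.inl ⟨hM, Or.inr ⟨hgt, signCondition_of_lie e1 ?_⟩⟩)
    by_contra! hle
    have hle' : 0 ≤ S.lie 1 (S.obsIndex 1 + 1) ξ := by linarith
    have hsign : S.LieSign 1 1 ξ := by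
      rcases hle'.lt_or_eq with hp | hzero
      · exact lieSign_of_forall_le le_rfl e1 (by linarith)
      · refine Or.inl fun l hl => ?_
        rcases hl.lt_or_eq with hl | rfl
        exacts [e1 l (by omega), hzero.symm]
    have := (hS.eq_of_lieSign (lieSign_of_forall_le hgt.le e0 (by rw [e2]; norm_num)) hsign).1
      (S.obsIndex 1 + 1) (by omega)
    linarith

/-! ### The equal-index case and the kernel condition. -/

theorem EqualIndexCondition.lieTriangular {S : BimodalSystem n} (h : S.EqualIndexCondition) :
    S.LieTriangular (S.minIndex + 1) := by
  obtain ⟨-, M, hM, hT, hE⟩ := h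
  exact lieTriangular_of_isLowerPos hM hT hE

theorem EqualIndexCondition.isRegular {S : BimodalSystem n} (h : S.EqualIndexCondition)
    (hK : S.KernelCondition) : S.IsRegular (S.minIndex + 1) where
  lieTriangular := h.lieTriangular
  obsRow_mem := by
    rw [show S.minIndex = S.obsIndex 1 from min_eq_right h.1.ge]
    exact exists_sum_range_of_mem_span (S.obsRow_obsIndex_succ_mem 1)
  mode_eq ξ hξ := hK ξ ((S.T_mulVec_add_E_eq_zero 0 _ ξ).2 (h.lieTriangular.lie_zero_eq_zero hξ))

/-- At a point of the kernel all Lie derivatives along both modes vanish, so both flows stay on the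
hyperplane and must coincide. -/
theorem RightUniqueness.kernelCondition {S : BimodalSystem n} (hS : S.RightUniqueness)
    (h : S.EqualIndexCondition) : S.KernelCondition := by
  intro ξ hξ
  have h0 := (S.T_mulVec_add_E_eq_zero 0 _ ξ).1 hξ
  have h1 := h.lieTriangular.lie_one_eq_zero h0
  have hm0 : S.minIndex = S.obsIndex 0 := min_eq_left h.1.le
  have hm1 : S.minIndex = S.obsIndex 1 := min_eq_right h.1.ge
  rw [hm0] at h0
  rw [hm1] at h1
  exact (hS.eq_of_lieSign (Or.inl h0) (Or.inl h1)).2.2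

end BimodalSystem

end

theorem theorem2 (n : ℕ) (S : BimodalSystem n) :
    (S.RightUniqueness →
      S.LexCondition ∨ S.UnequalIndexCondition ∨ S.EqualIndexCondition) ∧
    (S.RightUniqueness ∧ S.EqualIndexCondition → S.KernelCondition) ∧
    (S.EqualIndexCondition ∧ S.KernelCondition → S.FilippovIsCaratheodory) ∧
    (S.EqualIndexCondition ∧ S.KernelCondition → S.RightUniqueness) :=
  ⟨fun h => h.conditions, fun h => h.1.kernelCondition h.2,
    fun h => (h.1.isRegular h.2).filippovIsCaratheodory,
    fun h => (h.1.isRegular h.2).rightUniqueness⟩
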